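/- Notation. Let $e_1=(1,1)$, $e_2=(-1,1)$. White vertices are the $x=(x_1,x_2)\in\mathbb Z^2$ with $x_1$ odd and $x_2$ even; black vertices are the $y=(y_1,y_2)\in\mathbb Z^2$ with $y_1$ even and $y_2$ odd. For $\varepsilon\in\{0,1\}$ let $\mathtt W_\varepsilon$ and $\mathtt B_\varepsilon$ be the sets of white, respectively black, vertices whose coordinate sum is congruent to $2\varepsilon+1$ modulo $4$. A fundamental domain is a set $\{\mathbf u,\mathbf u+e_1,\mathbf u+e_2,\mathbf u+e_1+e_2\}$ with $\mathbf u\in\mathtt W_0$. For $0<a<1$ put $$\mathcal K_a(z,w)=\begin{pmatrix} i(a+w^{-1}) & a+z\\ a+z^{-1} & i(a+w)\end{pmatrix},$$ with rows and columns indexed by $0,1$. The whole-plane inverse Kasteleyn matrix with edge weights $a$ and $1$ and zero magnetic field is defined, for $\mathbf w\in \mathtt W_{\varepsilon_1}$ and $\mathbf b\in \mathtt B_{\varepsilon_2}$ in the same fundamental domain and $u,v\in\mathbb Z$, by $$\mathbb K_{a,0,0}^{-1}(\mathbf w,\mathbf b+2ue_1+2ve_2)=\frac1{(2\pi i)^2}\int_{|z|=1}\frac{dz}{z}\int_{|w|=1}\frac{dw}{w}\,\bigl(\mathcal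 K_a(z,w)^{-1}\bigr)_{\varepsilon_1\varepsilon_2}z^uw^v .$$ For $x$ white and $y$ black let $\zeta(x,y)=(-1)^{(y_2-x_1)/2}$, and let $\Sigma(x,y)=1$ if $y-x=pe_1+qe_2$ with $p$ odd and $q$ even, and $\Sigma(x,y)=i$ if $y-x=pe_1+qe_2$ with $p$ even and $q$ odd (exactly one of these holds). For $-1\le z\le -3+2\sqrt2$ let $$\theta(z)=\frac1{2z}\Bigl(i\sqrt{4z^2-(4z+z^2+1)^2}-(4z+z^2+1)\Bigr),\qquad k^{(v)}(z)=\frac{\theta(z)^v+\theta(z)^{-v}}2\in\mathbb R,$$ $$b(z)=-\frac12\log\left(\frac{4\sqrt2(1+z)}{1-z+\sqrt{-1-6z-z^2}}\right).$$ For $p$ odd and $q$ even let $$c_0(pe_1+qe_2)=\frac1\pi\int_{-1}^{-3+2\sqrt2}\frac{z^{(|p|-1)/2}k^{(q/2)}(z)}{\sqrt{-1-6z-z^2}}\,dz,\qquad c_1(pe_1+qe_2)=\frac1{2\pi},$$ $$c_2(pe_1+qe_2)=\frac{(-1)^{q/2}}\pi\left(\int_{-1}^{-3+2\sqrt2}\Bigl(\tfrac12(-z)^{(|p|-1)/2}+\sum_{i=0}^{(|p|-3)/2}(-z)^i\Bigr)\frac{k^{(q/2)}(z)}{\sqrt{-1-6z-z^2}}\,dz-\log2-\int_{-1}^{-3+2\sqrt2}\frac{dk^{(q/2)}}{dz}(z)\,b(z)\,dz\right),$$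 where the finite sum is empty for $|p|=1$; for $p$ even and $q$ odd let $c_i(pe_1+qe_2)=c_i(qe_1+pe_2)$, $i=0,1,2$. Theorem. Let $B>0$ be fixed and let $a=1-Bm^{-1/2}$, $m\in\mathbb N$. Then, as $m\to\infty$, for $x$ white and $y$ black, $$\mathbb K_{a,0,0}^{-1}(x,y)=\frac1{\Sigma(x,y)}\Bigl(c_0(y-x)+\tfrac12c_0(y-x)Bm^{-1/2}+\zeta(x,y)\bigl(c_1(y-x)Bm^{-1/2}\log(Bm^{-1/2})+c_2(y-x)Bm^{-1/2}\bigr)\Bigr)+O(m^{-1}\log m).$$ Precisely: for every $B>0$ and $R\in\mathbb N$ there is a constant $C$ such that for all sufficiently large $m$ and all white $x$ and black $y$ with $|y_1-x_1|\le R$ and $|y_2-x_2|\le R$, the absolute value of the difference between the left-hand side and the displayed main term on the right (without the error term) is at most $C\,m^{-1}\log m$. -/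

import Mathlib

open Filter

namespace TwoPeriodicAztec

noncomputable section

/-! The lattice of vertices, in the Euclidean coordinates of `ℤ × ℤ`. -/

/-- The vector `e₁ = (1, 1)`. -/
def e1 : ℤ × ℤ := (1, 1)

/-- The vector `e₂ = (-1, 1)`. -/
def e2 : ℤ × ℤ := (-1, 1)

/-- White vertices: first coordinate odd, second coordinate even. -/
def IsWhite (x : ℤ × ℤ) : Prop := Odd x.1 ∧ Even x.2

/-- Black vertices: first coordinate even, second coordinate odd. -/
def IsBlack (y : ℤ × ℤ) : Prop := Even y.1 ∧ Odd y.2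

/-- The class `W_ε`, `ε ∈ {0, 1}`, of white vertices. -/
def IsWhiteType (ε : Fin 2) (x : ℤ × ℤ) : Prop :=
  IsWhite x ∧ x.1 + x.2 ≡ 2 * (ε.val : ℤ) + 1 [ZMOD 4]

/-- The class `B_ε`, `ε ∈ {0, 1}`, of black vertices. -/
def IsBlackType (ε : Fin 2) (y : ℤ × ℤ) : Prop :=
  IsBlack y ∧ y.1 + y.2 ≡ 2 * (ε.val : ℤ) + 1 [ZMOD 4]

/-- The four vertices of the fundamental domain of a vertex `w ∈ W_0`. -/
def fundamentalDomain (w : ℤ × ℤ) : Set (ℤ × ℤ) :=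
  {w, w + e1, w + e2, w + e1 + e2}

/-- The index `ε` of a vertex: `0` if its coordinate sum is `1` modulo `4`, else `1`. -/
def vertexType (x : ℤ × ℤ) : Fin 2 := if (x.1 + x.2) % 4 = 1 then 0 else 1

/-- The vector from the white vertex of type `ε₁` to the black vertex of type `ε₂` inside one
fundamental domain. -/
def domainOffset (ε₁ ε₂ : Fin 2) : ℤ × ℤ := !![e2, e1; -e1, -e2] ε₁ ε₂

/-! The whole-plane inverse Kasteleyn matrix. -/

/-- The magnetically altered Kasteleyn matrix `𝒦_a(z, w)` of the fundamental domain
(rows: black vertices, columns: white vertices). -/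
def magneticKasteleyn (a : ℝ) (z w : ℂ) : Matrix (Fin 2) (Fin 2) ℂ :=
  !![Complex.I * (a + w⁻¹), a + z; a + z⁻¹, Complex.I * (a + w)]

/-- The double torus integral
`(2πi)⁻² ∫_{|z| = e^H} dz/z ∫_{|w| = e^V} dw/w (𝒦_a(z, w)⁻¹)_{ε₁ ε₂} z^u w^v`. -/
def torusIntegral (a H V : ℝ) (ε₁ ε₂ : Fin 2) (u v : ℤ) : ℂ :=
  1 / (2 * Real.pi * Complex.I) ^ 2 *
    ∮ z in C(0, Real.exp H), 1 / z *
      ∮ w in C(0, Real.exp V), 1 / w * ((magneticKasteleyn a z w)⁻¹ ε₁ ε₂ * z ^ u * w ^ v)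

/-- The entry at `(x, y)` (`x` white, `y` black) of the whole-plane inverse Kasteleyn matrix
`𝕂_{a,H,V}⁻¹` with edge weights `a` and `1` and magnetic field `(H, V)`. If `ε₁, ε₂` are the types
of `x, y`, then `y = b + 2 u e₁ + 2 v e₂` where `b` is the black vertex of type `ε₂` in the
fundamental domain of `x`; see `planeInverse_eq`. -/
def planeInverse (a H V : ℝ) (x y : ℤ × ℤ) : ℂ :=
  torusIntegral a H V (vertexType x) (vertexType y)
    (((y - x - domainOffset (vertexType x) (vertexType y)).1 +
      (y - x - domainOffset (vertexType x) (vertexType y)).2) / 4)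
    (((y - x - domainOffset (vertexType x) (vertexType y)).2 -
      (y - x - domainOffset (vertexType x) (vertexType y)).1) / 4)

theorem vertexType_eq {ε : Fin 2} {x : ℤ × ℤ}
    (h : x.1 + x.2 ≡ 2 * (ε.val : ℤ) + 1 [ZMOD 4]) : vertexType x = ε := by
  unfold vertexType
  unfold Int.ModEq at h
  fin_cases ε
  · simp at h ⊢
    omega
  · simp at h ⊢
    omega

/-- The characterisation of `planeInverse`: for `w ∈ W_{ε₁}` and `b ∈ B_{ε₂}` in the same
fundamental domain, the entry at `(w, b + 2 u e₁ + 2 v e₂)` is the double torus integral. -/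
theorem planeInverse_eq (a H V : ℝ) {ε₁ ε₂ : Fin 2} {w₀ w b : ℤ × ℤ} (hw₀ : IsWhiteType 0 w₀)
    (hw : IsWhiteType ε₁ w) (hb : IsBlackType ε₂ b) (hwd : w ∈ fundamentalDomain w₀)
    (hbd : b ∈ fundamentalDomain w₀) (u v : ℤ) :
    planeInverse a H V w (b + (2 * u) • e1 + (2 * v) • e2) =
      torusIntegral a H V ε₁ ε₂ u v := by
  have t1 : vertexType w = ε₁ := vertexType_eq hw.2
  have t2 : vertexType (b + (2 * u) • e1 + (2 * v) • e2) = ε₂ := by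
    apply vertexType_eq
    have h2 := hb.2
    unfold Int.ModEq at h2 ⊢
    simp [e1, e2]
    omega
  have key : b - w = domainOffset ε₁ ε₂ := by
    obtain ⟨p, q⟩ := w₀
    obtain ⟨w1, w2⟩ := w
    obtain ⟨b1, b2⟩ := b
    obtain ⟨⟨h1, h2⟩, h3⟩ := hw₀
    obtain ⟨⟨h4, h5⟩, h6⟩ := hw
    obtain ⟨⟨h7, h8⟩, h9⟩ := hb
    simp only [fundamentalDomain, e1, e2, Set.mem_insert_iff, Set.mem_singleton_iff,
      Prod.mk_add_mk, Prod.mk.injEq] at hwd hbd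
    unfold Int.ModEq at h3 h6 h9
    rw [Int.odd_iff] at h1 h4 h8
    rw [Int.even_iff] at h2 h5 h7
    fin_cases ε₁ <;> fin_cases ε₂ <;> simp [domainOffset, e1, e2] at * <;> omega
  unfold planeInverse
  rw [t1, t2]
  have hd : b + (2 * u) • e1 + (2 * v) • e2 - w - domainOffset ε₁ ε₂ =
      (2 * u) • e1 + (2 * v) • e2 := by
    rw [← key]; abel
  rw [hd]
  congr 1
  · simp [e1, e2]; omega
  · simp [e1, e2]; omega

/-! The sign `ζ` and the phase `Σ`. -/

/-- `ζ(x, y) = (-1)^((y₂ - x₁) / 2)`; for `x` white and `y` black the exponent is an integer. -/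
def zetaSign (x y : ℤ × ℤ) : ℝ := (-1 : ℝ) ^ ((y.2 - x.1) / 2)

open Classical in
/-- `Σ(x, y)` is `1` if `y = x + (2k+1) e₁ + 2l e₂`, and `i` if `y = x + 2k e₁ + (2l+1) e₂`
(for `x` white and `y` black exactly one of the two holds). -/
def sigmaPhase (x y : ℤ × ℤ) : ℂ :=
  if ∃ k l : ℤ, y = x + (2 * k + 1) • e1 + (2 * l) • e2 then 1
  else if ∃ k l : ℤ, y = x + (2 * k) • e1 + (2 * l + 1) • e2 then Complex.I
  else 0

/-! The coefficients `c₀, c₁, c₂`. -/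

/-- `θ(z) = (i √(4z² - (4z + z² + 1)²) - (4z + z² + 1)) / (2z)`. -/
def theta (z : ℝ) : ℂ :=
  1 / (2 * z) * (Complex.I * Real.sqrt (4 * z ^ 2 - (4 * z + z ^ 2 + 1) ^ 2) -
    (4 * z + z ^ 2 + 1))

/-- `k^{(v)}(z) = (θ(z)^v + θ(z)^{-v}) / 2`, which is real on `[-1, -3 + 2√2]`
(see `kFun_eq`). -/
def kFun (v : ℤ) (z : ℝ) : ℝ := ((theta z ^ v + theta z ^ (-v)) / 2).re

theorem theta_norm {z : ℝ} (hz : -1 ≤ z) (hz' : z ≤ -3 + 2 * Real.sqrt 2) :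
    theta z * starRingEnd ℂ (theta z) = 1 := by
  have hs : Real.sqrt 2 ^ 2 = 2 := Real.sq_sqrt (by norm_num)
  have hs0 : 0 ≤ Real.sqrt 2 := Real.sqrt_nonneg 2
  have hs1 : Real.sqrt 2 < 3 / 2 := by nlinarith
  have hz0 : z ≠ 0 := by intro h; nlinarith
  have h1 : 0 ≤ -1 - 6 * z - z ^ 2 := by
    nlinarith [mul_nonneg (sub_nonneg.2 hz') (by nlinarith : 0 ≤ z + 3 + 2 * Real.sqrt 2)]
  have hD : 0 ≤ 4 * z ^ 2 - (4 * z + z ^ 2 + 1) ^ 2 := by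
    nlinarith [mul_nonneg (sq_nonneg (1 + z)) h1]
  have hq : ((Real.sqrt (4 * z ^ 2 - (4 * z + z ^ 2 + 1) ^ 2) : ℝ) : ℂ) ^ 2 =
      4 * z ^ 2 - (4 * z + z ^ 2 + 1) ^ 2 := by
    rw [← Complex.ofReal_pow, Real.sq_sqrt hD]; push_cast; ring
  have hzc : (z : ℂ) ≠ 0 := by exact_mod_cast hz0
  unfold theta
  simp only [map_mul, map_sub, map_div₀, map_one, map_add, map_pow, Complex.conj_I,
    Complex.conj_ofReal, map_ofNat]
  generalize ((Real.sqrt (4 * z ^ 2 - (4 * z + z ^ 2 + 1) ^ 2) : ℝ) : ℂ) = s at hq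
  field_simp
  have hI : Complex.I ^ 2 = -1 := Complex.I_sq
  linear_combination hq - s ^ 2 * hI

/-- On `[-1, -3 + 2√2]` the real part in the definition of `kFun` changes nothing. -/
theorem kFun_eq (v : ℤ) {z : ℝ} (hz : -1 ≤ z) (hz' : z ≤ -3 + 2 * Real.sqrt 2) :
    (kFun v z : ℂ) = (theta z ^ v + theta z ^ (-v)) / 2 := by
  have h : starRingEnd ℂ (theta z) = (theta z)⁻¹ :=
    eq_inv_of_mul_eq_one_right (theta_norm hz hz')
  unfold kFun
  rw [← Complex.conj_eq_iff_re]
  simp only [map_div₀, map_add, map_zpow₀, map_ofNat, h, inv_zpow', neg_neg]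
  ring

/-- `b(z) = -(1/2) log (4√2 (1 + z) / (1 - z + √(-1 - 6z - z²)))`. -/
def bFun (z : ℝ) : ℝ :=
  -(1 / 2) * Real.log (4 * Real.sqrt 2 * (1 + z) / (1 - z + Real.sqrt (-1 - 6 * z - z ^ 2)))

/-- `c₀(p e₁ + q e₂)` for `p` odd and `q` even. -/
def c0Odd (p q : ℤ) : ℝ :=
  1 / Real.pi * ∫ z in (-1 : ℝ)..(-3 + 2 * Real.sqrt 2),
    z ^ ((p.natAbs - 1) / 2) * kFun (q / 2) z / Real.sqrt (-1 - 6 * z - z ^ 2)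

/-- `c₂(p e₁ + q e₂)` for `p` odd and `q` even; the finite sum runs over
`0 ≤ i ≤ (|p| - 3) / 2` and is empty for `|p| = 1`. -/
def c2Odd (p q : ℤ) : ℝ :=
  (-1 : ℝ) ^ (q / 2) / Real.pi *
    ((∫ z in (-1 : ℝ)..(-3 + 2 * Real.sqrt 2),
        (1 / 2 * (-z) ^ ((p.natAbs - 1) / 2) +
          ∑ i ∈ Finset.range ((p.natAbs - 1) / 2), (-z) ^ i) *
        (kFun (q / 2) z / Real.sqrt (-1 - 6 * z - z ^ 2)))
      - Real.log 2
      - ∫ z in (-1 : ℝ)..(-3 + 2 * Real.sqrt 2), deriv (kFun (q / 2)) z * bFun z)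

/-- The coordinate `p` of `d = p e₁ + q e₂`. -/
def coordP (d : ℤ × ℤ) : ℤ := (d.1 + d.2) / 2

/-- The coordinate `q` of `d = p e₁ + q e₂`. -/
def coordQ (d : ℤ × ℤ) : ℤ := (d.2 - d.1) / 2

theorem coord_eq (p q : ℤ) :
    coordP (p • e1 + q • e2) = p ∧ coordQ (p • e1 + q • e2) = q := by
  constructor
  · simp [coordP, e1, e2]; omega
  · simp [coordQ, e1, e2]; omega

/-- A function of `d = p e₁ + q e₂` given by `F p q` for `p` odd, `q` even and by `F q p` for
`p` even, `q` odd. -/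
def symmetrize (F : ℤ → ℤ → ℝ) (d : ℤ × ℤ) : ℝ :=
  if Odd (coordP d) ∧ Even (coordQ d) then F (coordP d) (coordQ d)
  else if Even (coordP d) ∧ Odd (coordQ d) then F (coordQ d) (coordP d)
  else 0

/-- The coefficient `c₀`. -/
def c0 : ℤ × ℤ → ℝ := symmetrize c0Odd

/-- The coefficient `c₁`. -/
def c1 : ℤ × ℤ → ℝ := symmetrize fun _ _ => 1 / (2 * Real.pi)

/-- The coefficient `c₂`. -/
def c2 : ℤ × ℤ → ℝ := symmetrize c2Odd

/-- The small parameter `h = B m^{-1/2}`. -/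
def smallParam (B : ℝ) (m : ℕ) : ℝ := B * (m : ℝ) ^ (-(1 / 2) : ℝ)

end

end TwoPeriodicAztec

open TwoPeriodicAztec

/-! Put `h = 1 - a`. On the torus `-det 𝒦_a` is `denom`, and each entry of the inverse is a unit
constant times `(a + monomial) / denom`. So `𝕂⁻¹(x, y)` is, up to the phase `1 / Σ`, a combination
`a G(k, l) + G(k + 1, l)` of Fourier coefficients of `1 / denom` (`exists_planeInverse_eq`).
Residues in one variable turn `G(k, l)` into `(-1)^(k + l)` times the cosine transform `g_|k|` of
`ρⁿ / (ρ⁻¹ - ρ)`, `n = |k|`, where `ρ + ρ⁻¹ = 2 + 4 (sin² (β / 2) + δ)` and `δ = h² / (2 (1 - h))`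
(`latticeGreen_eq`).

The sign alternates in `k`, so for `k = n ≥ 0` the combination is proportional to `g_n - g_{n+1} /
(1 - h)`. With `t = h / (1 - h)` this equals `(1 + t / 2) (g_n - g_{n+1}) - t (g_n + g_{n+1}) / 2`.
In the difference the factor `1 - ρ` cancels, leaving a smooth function of `ρ`, whose transform
changes only by `O(h² (1 + |log h|))` when `δ` is set to `0` (`exists_abs_cosTransform_sub_le`);
this gives `c₀` and its correction `h / 2`. The mean is `g_0` minus another smooth transform, and
`g_0 = -(1/2) log h + (3/4) log 2 + regularPart + O(h)` (`exists_abs_massiveGreen_sub_log_le`);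
since it is multiplied by `t`, it produces the terms with `c₁` and `c₂`.

The coefficients are matched by the substitution `z = -ρ` at `δ = 0`, under which `θ(z) = -e^{iβ}`
and `k^{(v)}(z) = (-1)^v cos (v β)`. The integral with `b` in `c₂` is `regularPart` after an
integration by parts (`regularPart_eq`). -/

namespace TwoPeriodicAztec

/-! ### The characteristic root and its modulus of continuity -/

/-- The root in `(0, 1]` of `r + r⁻¹ = 2 + 4 S`. -/
noncomputable def rho (S : ℝ) : ℝ := (√(1 + S) - √S) ^ 2

theorem sqrt_lt_sqrt_one_add {S : ℝ} (hS : 0 ≤ S) : √S < √(1 + S) :=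
  Real.sqrt_lt_sqrt hS (by linarith)

theorem sq_sqrt_one_add {S : ℝ} (hS : 0 ≤ S) : √(1 + S) ^ 2 = 1 + √S ^ 2 := by
  rw [Real.sq_sqrt hS, Real.sq_sqrt (by linarith)]

theorem rho_pos {S : ℝ} (hS : 0 ≤ S) : 0 < rho S :=
  pow_pos (sub_pos.2 (sqrt_lt_sqrt_one_add hS)) 2

theorem rho_mul {S : ℝ} (hS : 0 ≤ S) : rho S * (√(1 + S) + √S) ^ 2 = 1 := by
  have h := sq_sqrt_one_add hS
  have : (√(1 + S) - √S) * (√(1 + S) + √S) = 1 := by linear_combination h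
  rw [rho, ← mul_pow, this, one_pow]

theorem inv_rho {S : ℝ} (hS : 0 ≤ S) : (rho S)⁻¹ = (√(1 + S) + √S) ^ 2 :=
  inv_eq_of_mul_eq_one_right (rho_mul hS)

theorem one_sub_rho {S : ℝ} (hS : 0 ≤ S) : 1 - rho S = 2 * √S * (√(1 + S) - √S) := by
  rw [rho]; linear_combination -(sq_sqrt_one_add hS)

theorem rho_le_one {S : ℝ} (hS : 0 ≤ S) : rho S ≤ 1 := by
  have h := one_sub_rho hS
  have := mul_nonneg (mul_nonneg zero_le_two (Real.sqrt_nonneg S))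
    (sub_pos.2 (sqrt_lt_sqrt_one_add hS)).le
  linarith

theorem rho_lt_one {S : ℝ} (hS : 0 < S) : rho S < 1 := by
  have h := one_sub_rho hS.le
  have := mul_pos (mul_pos zero_lt_two (Real.sqrt_pos.2 hS))
    (sub_pos.2 (sqrt_lt_sqrt_one_add hS.le))
  linarith

theorem rho_add_inv {S : ℝ} (hS : 0 ≤ S) : rho S + (rho S)⁻¹ = 2 + 4 * S := by
  rw [inv_rho hS, rho]
  linear_combination 2 * (sq_sqrt_one_add hS) + 4 * Real.sq_sqrt hS

theorem inv_sub_rho {S : ℝ} (hS : 0 ≤ S) : (rho S)⁻¹ - rho S = 4 * √S * √(1 + S) := by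
  rw [inv_rho hS, rho]; ring

theorem continuous_rho : Continuous rho := by
  unfold rho; fun_prop

theorem rho_mem_Icc {S : ℝ} (hS : 0 ≤ S) : rho S ∈ Set.Icc (0 : ℝ) 1 :=
  ⟨(rho_pos hS).le, rho_le_one hS⟩

/-- The quantitative continuity of `rho`. -/
theorem abs_rho_add_sub_le {S δ : ℝ} (hS : 0 ≤ S) (hδ : 0 < δ) :
    |rho (S + δ) - rho S| ≤ 2 * δ / √(S + δ) := by
  have hS' : 0 ≤ S + δ := by linarith
  have e0 := rho_add_inv hS
  have e1 := rho_add_inv hS'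
  have p0 := rho_pos hS
  have p1 := rho_pos hS'
  have l0 := rho_le_one hS
  have l1 := rho_lt_one (by linarith : 0 < S + δ)
  have o1 := one_sub_rho hS'
  have t1 : 0 < √(S + δ) := Real.sqrt_pos.2 (by linarith)
  have q1 : 0 < √(1 + (S + δ)) - √(S + δ) := sub_pos.2 (sqrt_lt_sqrt_one_add hS')
  have d1 : rho (S + δ) = (√(1 + (S + δ)) - √(S + δ)) ^ 2 := rfl
  have q2 : √(1 + (S + δ)) - √(S + δ) ≤ 1 := by
    by_contra! hq
    nlinarith
  -- Subtracting the two equations `r + r⁻¹ = 2 + 4 S` leaves the factor `1 - r r'`. It is at least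
  -- `1 - r'`, which is of order `√(S + δ)` near `0`; hence the bound stays useful even at `S = 0`.
  have key : (rho S - rho (S + δ)) * (1 - rho S * rho (S + δ)) =
      4 * δ * (rho S * rho (S + δ)) := by
    field_simp at e0 e1
    linear_combination rho S * e1 - rho (S + δ) * e0
  have h1 : 1 - rho (S + δ) ≤ 1 - rho S * rho (S + δ) := by nlinarith
  have hnn : 0 ≤ rho S - rho (S + δ) := by
    by_contra! hneg
    have : 0 < 4 * δ * (rho S * rho (S + δ)) := by positivity
    nlinarith
  rw [abs_sub_comm, abs_of_nonneg hnn, le_div_iff₀ t1]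
  have h2 : (rho S - rho (S + δ)) * (2 * √(S + δ) * (√(1 + (S + δ)) - √(S + δ))) ≤
      4 * δ * (rho S * (√(1 + (S + δ)) - √(S + δ)) ^ 2) := by
    rw [← o1, ← d1, ← key]
    exact mul_le_mul_of_nonneg_left h1 hnn
  have h3 : (rho S - rho (S + δ)) * (2 * √(S + δ)) ≤
      4 * δ * (rho S * (√(1 + (S + δ)) - √(S + δ))) := by
    refine le_of_mul_le_mul_right ?_ q1
    linarith
  have h4 : rho S * (√(1 + (S + δ)) - √(S + δ)) ≤ 1 := by nlinarith
  nlinarith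

theorem sin_sq_half_eq (β : ℝ) : Real.sin (β / 2) ^ 2 = 1 / 2 - Real.cos β / 2 := by
  rw [Real.sin_sq_eq_half_sub, mul_div_cancel₀ _ (two_ne_zero)]


/-! ### Residue calculus on the unit circle -/

/-- The point `e^{iθ}` of the unit circle. -/
noncomputable def cis (θ : ℝ) : ℂ := Complex.exp (θ * Complex.I)

theorem continuous_cis : Continuous cis := by unfold cis; fun_prop

theorem cis_ne_zero (θ : ℝ) : cis θ ≠ 0 := Complex.exp_ne_zero _

theorem cis_zpow (θ : ℝ) (n : ℤ) : cis θ ^ n = cis (n * θ) := by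
  unfold cis
  rw [← Complex.exp_int_mul]
  push_cast [mul_assoc]
  ring_nf

theorem cis_neg (θ : ℝ) : cis (-θ) = (cis θ)⁻¹ := by
  unfold cis
  rw [← Complex.exp_neg]
  push_cast
  congr 1
  ring

theorem cis_add_pi (θ : ℝ) : cis (θ + Real.pi) = -cis θ := by
  unfold cis
  push_cast
  rw [add_mul, Complex.exp_add, Complex.exp_pi_mul_I]
  ring

theorem cis_add_inv (θ : ℝ) : cis θ + (cis θ)⁻¹ = ((2 * Real.cos θ : ℝ) : ℂ) := by
  rw [← cis_neg]
  unfold cis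
  push_cast
  rw [Complex.two_cos]

theorem continuous_cis_zpow (n : ℤ) : Continuous fun θ => cis θ ^ n :=
  continuous_cis.zpow₀ n fun θ => Or.inl (cis_ne_zero θ)

theorem circleIntegral_one_div_mul (F : ℂ → ℂ) :
    (∮ w in C(0, 1), 1 / w * F w) = Complex.I * ∫ θ in 0..2 * Real.pi, F (cis θ) := by
  rw [circleIntegral, ← intervalIntegral.integral_const_mul]
  refine intervalIntegral.integral_congr fun θ _ => ?_
  have h : circleMap 0 1 θ = cis θ := by simp [circleMap, cis]
  have := cis_ne_zero θ
  simp only [deriv_circleMap, h, smul_eq_mul]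
  field_simp

theorem integral_cis_inv (F : ℂ → ℂ) :
    ∫ θ in 0..2 * Real.pi, F (cis θ)⁻¹ = ∫ θ in 0..2 * Real.pi, F (cis θ) := by
  have h := intervalIntegral.integral_comp_sub_left (a := 0) (b := 2 * Real.pi)
    (fun θ => F (cis θ)) (2 * Real.pi)
  rw [sub_self, sub_zero] at h
  rw [← h]
  refine intervalIntegral.integral_congr fun θ _ => ?_
  have : cis (2 * Real.pi - θ) = (cis θ)⁻¹ := by
    rw [← cis_neg]
    unfold cis
    push_cast
    rw [sub_eq_add_neg, add_mul, Complex.exp_add, Complex.exp_two_pi_mul_I, one_mul]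
  simp only [this]

/-- Cauchy's formula: `w (2 + 4 S + w + w⁻¹) = (w + ρ) (w + ρ⁻¹)` has the single root `-ρ` inside
the disk, and the value there of `wⁿ / (w + ρ⁻¹)` is the answer. -/
theorem integral_cis_pow_div {S : ℝ} (hS : 0 < S) (n : ℕ) :
    ∫ θ in 0..2 * Real.pi, cis θ ^ n / (2 + 4 * S + (cis θ + (cis θ)⁻¹)) =
      ((2 * Real.pi * ((-rho S) ^ n / (4 * √S * √(1 + S))) : ℝ) : ℂ) := by
  have hp := rho_pos hS.le
  have hl := rho_lt_one hS
  have hi := inv_sub_rho hS.le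
  have ha := rho_add_inv hS.le
  set r := rho S with hr
  have hone : 1 < r⁻¹ := (one_lt_inv₀ hp).2 hl
  have hrc : (r : ℂ) ≠ 0 := by exact_mod_cast hp.ne'
  have hsum : (2 + 4 * S : ℂ) = r + (r : ℂ)⁻¹ := by exact_mod_cast ha.symm
  have hne : ∀ w : ℂ, ‖w‖ ≤ 1 → w + (r : ℂ)⁻¹ ≠ 0 := by
    intro w hw h0
    have : w = -((r⁻¹ : ℝ) : ℂ) := by push_cast; linear_combination h0
    rw [this, norm_neg, Complex.norm_real, Real.norm_eq_abs, abs_of_pos (by positivity)] at hw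
    linarith
  have hne' : ∀ w : ℂ, ‖w‖ = 1 → w + (r : ℂ) ≠ 0 := by
    intro w hw h0
    have : w = -((r : ℝ) : ℂ) := by linear_combination h0
    rw [this, norm_neg, Complex.norm_real, Real.norm_eq_abs, abs_of_pos (by positivity)] at hw
    linarith
  have hd : DifferentiableOn ℂ (fun w : ℂ => w ^ n / (w + (r : ℂ)⁻¹)) (Metric.closedBall 0 1) := by
    refine DifferentiableOn.div (by fun_prop) (by fun_prop) fun w hw => hne w ?_
    simpa using hw
  have hC := hd.circleIntegral_sub_inv_smul (w := -(r : ℂ)) (by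
    simpa [abs_of_pos hp] using hl)
  have hcongr : (∮ w in C(0, 1), (w - -(r : ℂ))⁻¹ • (w ^ n / (w + (r : ℂ)⁻¹))) =
      ∮ w in C(0, 1), 1 / w * (w ^ n / (2 + 4 * S + (w + w⁻¹))) := by
    refine circleIntegral.integral_congr zero_le_one fun w hw => ?_
    have hw1 : ‖w‖ = 1 := by simpa using hw
    have hw0 : w ≠ 0 := by intro h; simp [h] at hw1
    have h1 := hne w hw1.le
    have h2 := hne' w hw1
    have h3 : w * (2 + 4 * S + (w + w⁻¹)) = (w + r) * (w + (r : ℂ)⁻¹) := by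
      rw [hsum]; field_simp; ring
    simp only [smul_eq_mul, sub_neg_eq_add]
    rw [inv_mul_eq_div, div_div, one_div, inv_mul_eq_div, div_div,
      mul_comm (w + (r : ℂ)⁻¹), ← h3, mul_comm w]
  rw [hcongr, circleIntegral_one_div_mul (fun w => w ^ n / (2 + 4 * S + (w + w⁻¹)))] at hC
  have hI := Complex.I_ne_zero
  have : (∫ θ in 0..2 * Real.pi, cis θ ^ n / (2 + 4 * S + (cis θ + (cis θ)⁻¹))) =
      2 * Real.pi * ((-(r : ℂ)) ^ n / (-r + (r : ℂ)⁻¹)) := by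
    apply mul_left_cancel₀ hI
    rw [hC, smul_eq_mul]
    ring
  rw [this]
  have hd2 : (-r + (r : ℂ)⁻¹) = ((4 * √S * √(1 + S) : ℝ) : ℂ) := by
    rw [← hi]; push_cast; ring
  rw [hd2]
  push_cast
  rfl

theorem integral_cis_zpow_div {S : ℝ} (hS : 0 < S) (n : ℤ) :
    ∫ θ in 0..2 * Real.pi, cis θ ^ n / (2 + 4 * S + (cis θ + (cis θ)⁻¹)) =
      ((2 * Real.pi * ((-rho S) ^ n.natAbs / (4 * √S * √(1 + S))) : ℝ) : ℂ) := by
  rw [← integral_cis_pow_div hS]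
  obtain ⟨k, rfl | rfl⟩ := Int.eq_nat_or_neg n
  · simp
  · rw [← integral_cis_inv fun w => w ^ (-k : ℤ).natAbs / (2 + 4 * S + (w + w⁻¹))]
    refine intervalIntegral.integral_congr fun θ _ => ?_
    simp [add_comm (cis θ)]

/-! ### Reduction of the inverse Kasteleyn matrix to Fourier coefficients -/

/-- The denominator `-det 𝒦_a` on the torus. -/
noncomputable def denom (a α β : ℝ) : ℝ :=
  2 * (1 + a ^ 2) + a * (2 * Real.cos α + 2 * Real.cos β)

theorem denom_pos {a : ℝ} (ha : 0 < a) (ha' : a < 1) (α β : ℝ) : 0 < denom a α β := by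
  have h1 := Real.neg_one_le_cos α
  have h2 := Real.neg_one_le_cos β
  have h3 : 0 < (1 - a) ^ 2 := pow_pos (by linarith) 2
  unfold denom
  nlinarith

/-- The integrand of the Fourier coefficients of `1 / denom`. -/
noncomputable def greenIntegrand (a : ℝ) (u v : ℤ) (α β : ℝ) : ℂ :=
  cis α ^ u * cis β ^ v / denom a α β

/-- The Fourier coefficients of `1 / denom`, up to normalisation. -/
noncomputable def latticeGreen (a : ℝ) (u v : ℤ) : ℂ :=
  ∫ α in 0..2 * Real.pi, ∫ β in 0..2 * Real.pi, greenIntegrand a u v α β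

theorem continuous_greenIntegrand {a : ℝ} (ha : 0 < a) (ha' : a < 1) (u v : ℤ) :
    Continuous (Function.uncurry (greenIntegrand a u v)) := by
  unfold Function.uncurry greenIntegrand
  refine Continuous.div ?_ ?_ ?_
  · exact ((continuous_cis_zpow u).comp continuous_fst).mul
      ((continuous_cis_zpow v).comp continuous_snd)
  · unfold denom; fun_prop
  · intro p
    exact_mod_cast (denom_pos ha ha' p.1 p.2).ne'

/-- Fubini and the symmetry of the denominator. This is what makes the cases `p` odd and `q` odd the
same up to exchanging coordinates. -/
theorem latticeGreen_swap {a : ℝ} (ha : 0 < a) (ha' : a < 1) (u v : ℤ) :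
    latticeGreen a u v = latticeGreen a v u := by
  unfold latticeGreen
  rw [MeasureTheory.intervalIntegral_intervalIntegral_swap]
  · refine intervalIntegral.integral_congr fun α _ => ?_
    refine intervalIntegral.integral_congr fun β _ => ?_
    simp only [greenIntegrand, denom]
    rw [mul_comm, add_comm (2 * Real.cos β)]
  · exact ((continuous_greenIntegrand ha ha' u v).continuousOn.integrableOn_compact
      (isCompact_uIcc.prod isCompact_uIcc)).mono_set
      (Set.prod_mono Set.uIoc_subset_uIcc Set.uIoc_subset_uIcc)

theorem integral_greenIntegrand_add {a : ℝ} (ha : 0 < a) (ha' : a < 1) (c d : ℂ)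
    (u v u' v' : ℤ) :
    ∫ α in 0..2 * Real.pi, ∫ β in 0..2 * Real.pi,
      (c * greenIntegrand a u v α β + d * greenIntegrand a u' v' α β) =
      c * latticeGreen a u v + d * latticeGreen a u' v' := by
  have hc := fun u v α => (continuous_greenIntegrand ha ha' u v).comp
    (continuous_const (y := α) |>.prodMk continuous_id)
  have hi := fun u v => intervalIntegral.continuous_parametric_intervalIntegral_of_continuous'
    (μ := MeasureTheory.volume) (continuous_greenIntegrand ha ha' u v) 0 (2 * Real.pi)
  unfold latticeGreen
  rw [← intervalIntegral.integral_const_mul, ← intervalIntegral.integral_const_mul,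
    ← intervalIntegral.integral_add]
  · refine intervalIntegral.integral_congr fun α _ => ?_
    rw [intervalIntegral.integral_add, intervalIntegral.integral_const_mul,
      intervalIntegral.integral_const_mul]
    · exact ((hc u v α).const_smul c).intervalIntegrable _ _
    · exact ((hc u' v' α).const_smul d).intervalIntegrable _ _
  · exact ((hi u v).const_smul c).intervalIntegrable _ _
  · exact ((hi u' v').const_smul d).intervalIntegrable _ _

theorem torusIntegral_eq (a : ℝ) (ε₁ ε₂ : Fin 2) (u v : ℤ) :
    torusIntegral a 0 0 ε₁ ε₂ u v = 1 / (4 * Real.pi ^ 2) *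
      ∫ α in 0..2 * Real.pi, ∫ β in 0..2 * Real.pi,
        (magneticKasteleyn a (cis α) (cis β))⁻¹ ε₁ ε₂ * cis α ^ u * cis β ^ v := by
  unfold torusIntegral
  rw [Real.exp_zero]
  have h1 : ∀ z : ℂ, (∮ w in C(0, 1), 1 / w * ((magneticKasteleyn a z w)⁻¹ ε₁ ε₂ * z ^ u * w ^ v))
      = Complex.I * ∫ β in 0..2 * Real.pi,
        (magneticKasteleyn a z (cis β))⁻¹ ε₁ ε₂ * z ^ u * cis β ^ v :=
    fun z => circleIntegral_one_div_mul
      (fun w => (magneticKasteleyn a z w)⁻¹ ε₁ ε₂ * z ^ u * w ^ v)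
  simp only [h1]
  rw [circleIntegral_one_div_mul (fun z => Complex.I * ∫ β in 0..2 * Real.pi,
        (magneticKasteleyn a z (cis β))⁻¹ ε₁ ε₂ * z ^ u * cis β ^ v),
    intervalIntegral.integral_const_mul]
  have hpi : (Real.pi : ℂ) ≠ 0 := by exact_mod_cast Real.pi_ne_zero
  have hI := Complex.I_ne_zero
  field_simp
  ring

theorem det_magneticKasteleyn (a α β : ℝ) :
    (magneticKasteleyn a (cis α) (cis β)).det = -(denom a α β : ℂ) := by
  have h1 := cis_add_inv α
  have h2 := cis_add_inv β
  have h3 := mul_inv_cancel₀ (cis_ne_zero α)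
  have h4 := mul_inv_cancel₀ (cis_ne_zero β)
  push_cast at h1 h2
  simp only [magneticKasteleyn, Matrix.det_fin_two_of, denom]
  push_cast
  linear_combination (a + (cis β)⁻¹) * (a + cis β) * Complex.I_sq - a * h1 - a * h2 - h3 - h4

theorem inv_magneticKasteleyn (a α β : ℝ) :
    (magneticKasteleyn a (cis α) (cis β))⁻¹ =
      (-(denom a α β : ℂ)⁻¹) • !![Complex.I * (a + cis β), -(a + cis α);
        -(a + (cis α)⁻¹), Complex.I * (a + (cis β)⁻¹)] := by
  rw [Matrix.inv_def, det_magneticKasteleyn, Ring.inverse_eq_inv', inv_neg]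
  simp [magneticKasteleyn, Matrix.adjugate_fin_two_of]

/-- Common form of the four entries: `c` is `1` off the diagonal and `1 / i` on it, which is the
phase `1 / Σ`, and the primed exponents differ from the unprimed ones by one step. -/
theorem torusIntegral_eq_latticeGreen {a : ℝ} (ha : 0 < a) (ha' : a < 1) {ε₁ ε₂ : Fin 2}
    {c : ℂ} {u v u' v' : ℤ}
    (h : ∀ α β, (magneticKasteleyn a (cis α) (cis β))⁻¹ ε₁ ε₂ * cis α ^ u * cis β ^ v =
      c * (a * (cis α ^ u * cis β ^ v) + cis α ^ u' * cis β ^ v') / denom a α β) :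
    torusIntegral a 0 0 ε₁ ε₂ u v =
      c * (1 / (4 * Real.pi ^ 2)) * (a * latticeGreen a u v + latticeGreen a u' v') := by
  rw [torusIntegral_eq]
  have h2 : ∀ α β, (magneticKasteleyn a (cis α) (cis β))⁻¹ ε₁ ε₂ * cis α ^ u * cis β ^ v =
      c * a * greenIntegrand a u v α β + c * greenIntegrand a u' v' α β := by
    intro α β
    rw [h]
    unfold greenIntegrand
    ring
  simp only [h2]
  rw [integral_greenIntegrand_add ha ha']
  ring

theorem torusIntegral_zero_one {a : ℝ} (ha : 0 < a) (ha' : a < 1) (u v : ℤ) :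
    torusIntegral a 0 0 0 1 u v =
      1 * (1 / (4 * Real.pi ^ 2)) * (a * latticeGreen a u v + latticeGreen a (u + 1) v) := by
  refine torusIntegral_eq_latticeGreen ha ha' fun α β => ?_
  rw [inv_magneticKasteleyn, zpow_add_one₀ (cis_ne_zero α)]
  simp
  ring

theorem torusIntegral_one_zero {a : ℝ} (ha : 0 < a) (ha' : a < 1) (u v : ℤ) :
    torusIntegral a 0 0 1 0 u v =
      1 * (1 / (4 * Real.pi ^ 2)) * (a * latticeGreen a u v + latticeGreen a (u - 1) v) := by
  refine torusIntegral_eq_latticeGreen ha ha' fun α β => ?_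
  rw [inv_magneticKasteleyn, zpow_sub_one₀ (cis_ne_zero α)]
  simp
  ring

theorem torusIntegral_zero_zero {a : ℝ} (ha : 0 < a) (ha' : a < 1) (u v : ℤ) :
    torusIntegral a 0 0 0 0 u v = 1 / Complex.I *
      (1 / (4 * Real.pi ^ 2)) * (a * latticeGreen a u v + latticeGreen a u (v + 1)) := by
  refine torusIntegral_eq_latticeGreen ha ha' fun α β => ?_
  rw [inv_magneticKasteleyn, zpow_add_one₀ (cis_ne_zero β), one_div, Complex.inv_I]
  simp
  ring

theorem torusIntegral_one_one {a : ℝ} (ha : 0 < a) (ha' : a < 1) (u v : ℤ) :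
    torusIntegral a 0 0 1 1 u v = 1 / Complex.I *
      (1 / (4 * Real.pi ^ 2)) * (a * latticeGreen a u v + latticeGreen a u (v - 1)) := by
  refine torusIntegral_eq_latticeGreen ha ha' fun α β => ?_
  rw [inv_magneticKasteleyn, zpow_sub_one₀ (cis_ne_zero β), one_div, Complex.inv_I]
  simp
  ring

/-! ### The Green function as a single cosine integral -/

/-- The cosine transform `∫₀^π cos (v β) ρⁿ / (ρ⁻¹ - ρ) dβ` with `ρ = ρ (sin² (β / 2) + δ)`. -/
noncomputable def massiveGreen (δ : ℝ) (n : ℕ) (v : ℤ) : ℝ :=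
  ∫ β in 0..Real.pi, Real.cos (v * β) * (rho (Real.sin (β / 2) ^ 2 + δ) ^ n /
    (4 * √(Real.sin (β / 2) ^ 2 + δ) * √(1 + (Real.sin (β / 2) ^ 2 + δ))))

/-- The shift `α = β + π` moves the point `α = π`, where the denominator is smallest, to `β = 0` at
the cost of `(-1) ^ u`. Evenness then folds the integral onto `[0, π]`. -/
theorem integral_cis_mul_cos (u : ℤ) {F : ℝ → ℝ}
    (hF : Continuous fun β => F (1 / 2 - Real.cos β / 2)) :
    ∫ α in 0..2 * Real.pi, cis α ^ u * F (1 / 2 + Real.cos α / 2) =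
      (((-1) ^ u * (2 * ∫ β in 0..Real.pi, Real.cos (u * β) * F (Real.sin (β / 2) ^ 2)) : ℝ) : ℂ) := by
  simp only [sin_sq_half_eq]
  set f : ℝ → ℂ := fun β => cis β ^ u * F (1 / 2 - Real.cos β / 2) with hf
  have hfc : Continuous f := (continuous_cis_zpow u).mul (Complex.continuous_ofReal.comp hF)
  have h1 : ∫ α in 0..2 * Real.pi, cis α ^ u * F (1 / 2 + Real.cos α / 2) =
      ∫ β in -Real.pi..Real.pi, (-1) ^ u * f β := by
    have := intervalIntegral.integral_comp_add_right (a := -Real.pi) (b := Real.pi)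
      (fun α => cis α ^ u * (F (1 / 2 + Real.cos α / 2) : ℂ)) Real.pi
    rw [neg_add_cancel, ← two_mul] at this
    rw [← this]
    refine intervalIntegral.integral_congr fun β _ => ?_
    simp only [hf, cis_add_pi, Real.cos_add_pi]
    rw [neg_eq_neg_one_mul, mul_zpow, neg_div, ← sub_eq_add_neg, mul_assoc]
  rw [h1, intervalIntegral.integral_const_mul,
    ← intervalIntegral.integral_add_adjacent_intervals (b := 0) (hfc.intervalIntegrable _ _)
      (hfc.intervalIntegrable _ _)]
  have h2 : ∫ β in -Real.pi..0, f β = ∫ β in 0..Real.pi, f (-β) := by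
    rw [intervalIntegral.integral_comp_neg, neg_zero]
  have hfn : Continuous fun β => f (-β) := hfc.comp continuous_neg
  rw [h2, ← intervalIntegral.integral_add (hfn.intervalIntegrable _ _)
    (hfc.intervalIntegrable _ _)]
  push_cast
  rw [← intervalIntegral.integral_ofReal]
  congr 1
  rw [← intervalIntegral.integral_const_mul]
  refine intervalIntegral.integral_congr fun β _ => ?_
  simp only [hf, Real.cos_neg, cis_zpow, mul_neg, cis_neg]
  have h3 := cis_add_inv (u * β)
  push_cast at h3 ⊢
  linear_combination (F (1 / 2 - Real.cos β / 2) : ℂ) * h3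

theorem latticeGreen_eq {a : ℝ} (ha : 0 < a) (ha' : a < 1) (u v : ℤ) :
    latticeGreen a u v =
      ((4 * Real.pi / a * ((-1) ^ (u + v) *
        massiveGreen ((1 - a) ^ 2 / (2 * a)) u.natAbs v) : ℝ) : ℂ) := by
  rw [latticeGreen_swap ha ha']
  set δ := (1 - a) ^ 2 / (2 * a) with hδ
  have hδ0 : 0 < δ := div_pos (pow_pos (by linarith) 2) (by linarith)
  have hac : (a : ℂ) ≠ 0 := by exact_mod_cast ha.ne'
  set F : ℝ → ℝ := fun t => rho (t + δ) ^ u.natAbs / (4 * √(t + δ) * √(1 + (t + δ))) with hF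
  have hin : ∀ α, ∫ β in 0..2 * Real.pi, greenIntegrand a v u α β =
      ((2 * Real.pi / a * (-1) ^ u : ℝ) : ℂ) * (cis α ^ v * F (1 / 2 + Real.cos α / 2)) := by
    intro α
    have hS : 0 < 1 / 2 + Real.cos α / 2 + δ := by
      have := Real.neg_one_le_cos α
      linarith
    have h := integral_cis_zpow_div hS u
    have h2 : ∀ β, greenIntegrand a v u α β = cis α ^ v / a * (cis β ^ u /
        (2 + 4 * ((1 / 2 + Real.cos α / 2 + δ : ℝ) : ℂ) + (cis β + (cis β)⁻¹))) := by
      intro β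
      -- The value of `δ` is forced here: `2 (1 + a²) = a (4 + 4 δ)`.
      have h3 : (denom a α β : ℂ) = a *
          (2 + 4 * ((1 / 2 + Real.cos α / 2 + δ : ℝ) : ℂ) + (cis β + (cis β)⁻¹)) := by
        rw [cis_add_inv]
        norm_cast
        rw [denom, hδ]
        field_simp
        ring
      rw [greenIntegrand, h3, mul_comm (a : ℂ), div_mul_eq_div_div_swap, mul_div_right_comm,
        mul_div_assoc]
    simp only [h2]
    rw [intervalIntegral.integral_const_mul, h, neg_pow]
    have h5 : ((-1 : ℝ)) ^ u = (-1) ^ u.natAbs := by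
      obtain ⟨k, h | h⟩ := Int.eq_nat_or_neg u
      · simp [h]
      · simp [h, ← inv_pow]
    rw [h5]
    simp only [hF]
    push_cast
    ring
  unfold latticeGreen
  simp only [hin]
  rw [intervalIntegral.integral_const_mul, integral_cis_mul_cos]
  · rw [← Complex.ofReal_mul]
    congr 1
    rw [massiveGreen, zpow_add₀ (by norm_num)]
    ring
  · simp only [hF]
    have hpos : ∀ β : ℝ, 0 < 1 / 2 - Real.cos β / 2 + δ := fun β => by
      have := Real.cos_le_one β
      linarith
    refine Continuous.div ?_ (by fun_prop) ?_
    · exact (continuous_rho.comp (by fun_prop)).pow _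
    · intro β
      have h1 := Real.sqrt_pos.2 (hpos β)
      have h2 : 0 < √(1 + (1 / 2 - Real.cos β / 2 + δ)) :=
        Real.sqrt_pos.2 (by linarith [hpos β])
      positivity


/-! ### Asymptotics of the cosine integrals as the mass tends to zero -/

theorem div_pi_le_sin_half {β : ℝ} (h0 : 0 ≤ β) (h1 : β ≤ Real.pi) :
    β / Real.pi ≤ Real.sin (β / 2) := by
  simpa using Real.mul_le_sin (x := β / 2) (by positivity) (by linarith)

theorem sin_half_pos {β : ℝ} (h0 : 0 < β) (h1 : β ≤ Real.pi) : 0 < Real.sin (β / 2) :=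
  (div_pos h0 Real.pi_pos).trans_le (div_pi_le_sin_half h0.le h1)

/-- The integral `∫₀^π cos (v β) P(ρ (sin² (β / 2) + δ)) dβ`. -/
noncomputable def cosTransform (P : ℝ → ℝ) (v : ℤ) (δ : ℝ) : ℝ :=
  ∫ β in 0..Real.pi, Real.cos (v * β) * P (rho (Real.sin (β / 2) ^ 2 + δ))

theorem continuous_comp_rho {P : ℝ → ℝ} (hP : ContinuousOn P (Set.Icc 0 1)) (v : ℤ) {δ : ℝ}
    (hδ : 0 ≤ δ) :
    Continuous fun β : ℝ => Real.cos (v * β) * P (rho (Real.sin (β / 2) ^ 2 + δ)) := by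
  refine Continuous.mul (by fun_prop) (hP.comp_continuous (continuous_rho.comp (by fun_prop)) ?_)
  exact fun β => rho_mem_Icc (by positivity)

theorem abs_mul_cos_le (x y : ℝ) : |Real.cos y * x| ≤ |x| := by
  rw [abs_mul]
  exact mul_le_of_le_one_left (abs_nonneg x) (Real.abs_cos_le_one y)

theorem integral_inv_sqrt_sq_add {δ : ℝ} (hδ : 0 < δ) :
    ∫ β in 0..Real.pi, (√((β / Real.pi) ^ 2 + δ))⁻¹ = Real.pi * Real.arsinh (1 / √δ) := by
  have hπ := Real.pi_pos
  have hs := Real.sqrt_pos.2 hδ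
  have hpos : ∀ β : ℝ, 0 < (β / Real.pi) ^ 2 + δ := fun β => by positivity
  have hd : ∀ β : ℝ, HasDerivAt (fun β => Real.pi * Real.arsinh (β / Real.pi / √δ))
      (√((β / Real.pi) ^ 2 + δ))⁻¹ β := by
    intro β
    have h := ((((hasDerivAt_id β).div_const Real.pi).div_const √δ).arsinh).const_mul Real.pi
    refine h.congr_deriv ?_
    have h1 : √((β / Real.pi) ^ 2 + δ) = √δ * √(1 + (β / Real.pi / √δ) ^ 2) := by
      rw [← Real.sqrt_mul hδ.le, div_pow _ (√δ), Real.sq_sqrt hδ.le]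
      congr 1
      field_simp
      ring
    have h2 : 0 < √(1 + (β / Real.pi / √δ) ^ 2) := Real.sqrt_pos.2 (by positivity)
    rw [h1, smul_eq_mul, id]
    field_simp
  rw [intervalIntegral.integral_eq_sub_of_hasDerivAt (fun β _ => hd β)]
  · simp
  · refine Continuous.intervalIntegrable ?_ _ _
    exact Continuous.inv₀ (by fun_prop) fun β => (Real.sqrt_pos.2 (hpos β)).ne'

/-- The integrand changes by at most `2 C δ / √(sin² (β / 2) + δ)`. Jordan's inequality replaces the
sine by `β / π`, and the resulting integral is explicit, of order `δ log (1 / δ)`. -/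
theorem abs_cosTransform_sub_le {P : ℝ → ℝ} {C : ℝ} (hC : 0 ≤ C)
    (hPc : ContinuousOn P (Set.Icc 0 1))
    (hP : ∀ x ∈ Set.Icc (0 : ℝ) 1, ∀ y ∈ Set.Icc (0 : ℝ) 1, |P x - P y| ≤ C * |x - y|)
    (v : ℤ) {δ : ℝ} (hδ : 0 < δ) :
    |cosTransform P v δ - cosTransform P v 0| ≤
      2 * Real.pi * C * δ * Real.arsinh (1 / √δ) := by
  have hπ := Real.pi_pos
  unfold cosTransform
  rw [← intervalIntegral.integral_sub ((continuous_comp_rho hPc v hδ.le).intervalIntegrable _ _)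
    ((continuous_comp_rho hPc v le_rfl).intervalIntegrable _ _)]
  have hpos : ∀ β : ℝ, 0 < (β / Real.pi) ^ 2 + δ := fun β => by positivity
  have hbd := intervalIntegral.norm_integral_le_of_norm_le (μ := MeasureTheory.volume)
    (f := fun β => Real.cos (v * β) * P (rho (Real.sin (β / 2) ^ 2 + δ)) -
      Real.cos (v * β) * P (rho (Real.sin (β / 2) ^ 2 + 0)))
    (g := fun β => C * (2 * δ) * (√((β / Real.pi) ^ 2 + δ))⁻¹) hπ.le (Eventually.of_forall ?_) ?_
  · rw [Real.norm_eq_abs, intervalIntegral.integral_const_mul, integral_inv_sqrt_sq_add hδ] at hbd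
    linarith
  · intro β hβ
    have hσ := div_pi_le_sin_half hβ.1.le hβ.2
    have hσ0 : 0 ≤ β / Real.pi := by have := hβ.1.le; positivity
    rw [← mul_sub, Real.norm_eq_abs, add_zero]
    have hS : 0 ≤ Real.sin (β / 2) ^ 2 := sq_nonneg _
    refine (abs_mul_cos_le _ _).trans ((hP _ (rho_mem_Icc (by positivity)) _
      (rho_mem_Icc (by positivity))).trans ?_)
    rw [mul_assoc]
    refine mul_le_mul_of_nonneg_left ((abs_rho_add_sub_le hS hδ).trans ?_) hC
    rw [div_eq_mul_inv]
    have := hpos β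
    gcongr
  · refine Continuous.intervalIntegrable (continuous_const.mul ?_) _ _
    exact Continuous.inv₀ (by fun_prop) fun β => (Real.sqrt_pos.2 (hpos β)).ne'

/-- Write `arsinh (1 / √δ) = log (1 + √(1 + δ)) - (1/2) log δ`. The first term contributes `log 2`
and the `2` in the denominator of `δ` another `(1/2) log 2`; halving gives `(3/4) log 2`. -/
theorem abs_arsinh_sub_le {h : ℝ} (h0 : 0 < h) (h1 : h ≤ 1 / 2) :
    |1 / 2 * Real.arsinh (1 / √(h ^ 2 / (2 * (1 - h)))) -
      (-(1 / 2) * Real.log h + 3 / 4 * Real.log 2)| ≤ h := by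
  set δ := h ^ 2 / (2 * (1 - h)) with hδ
  have ha : 0 < 1 - h := by linarith
  have hδ0 : 0 < δ := by positivity
  have hδh : δ ≤ h := by
    rw [hδ, div_le_iff₀ (by linarith)]
    nlinarith
  have hs := Real.sqrt_pos.2 hδ0
  have hs2 : 1 ≤ √(1 + δ) := Real.one_le_sqrt.2 (by linarith)
  have hs3 : √(1 + δ) ≤ 1 + δ := by
    rw [Real.sqrt_le_left (by linarith)]
    nlinarith
  have e1 : Real.arsinh (1 / √δ) = Real.log (1 + √(1 + δ)) - 1 / 2 * Real.log δ := by
    rw [Real.arsinh, div_pow, Real.sq_sqrt hδ0.le, one_pow,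
      show 1 + 1 / δ = (1 + δ) / δ by field_simp; ring,
      Real.sqrt_div (by linarith : 0 ≤ 1 + δ), ← add_div,
      Real.log_div (by positivity) hs.ne', Real.log_sqrt hδ0.le]
    ring
  have e2 : Real.log δ = 2 * Real.log h - Real.log 2 - Real.log (1 - h) := by
    rw [hδ, Real.log_div (by positivity) (by positivity), Real.log_mul (by norm_num) ha.ne',
      Real.log_pow]
    push_cast
    ring
  have e3 : Real.log (1 + √(1 + δ)) = Real.log 2 + Real.log ((1 + √(1 + δ)) / 2) := by
    rw [Real.log_div (by positivity) (by norm_num)]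
    ring
  have b1 : 0 ≤ Real.log ((1 + √(1 + δ)) / 2) := Real.log_nonneg (by linarith)
  have b2 : Real.log ((1 + √(1 + δ)) / 2) ≤ h / 2 :=
    (Real.log_le_sub_one_of_pos (by positivity)).trans (by linarith)
  have b3 : Real.log (1 - h) ≤ 0 := Real.log_nonpos ha.le (by linarith)
  have b4 : -(2 * h) ≤ Real.log (1 - h) := by
    have := Real.one_sub_inv_le_log_of_pos ha
    refine le_trans ?_ this
    have : (1 - h)⁻¹ ≤ 1 + 2 * h := by
      rw [inv_le_iff_one_le_mul₀ ha]
      nlinarith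
    linarith
  rw [e1, e2, e3, abs_le]
  constructor <;> linarith

/-- The regular part `∫₀^π (4 sin (β / 2))⁻¹ (cos (v β) / √(1 + sin² (β / 2)) - cos (β / 2)) dβ`
of the cosine transform of the massless Green function. -/
noncomputable def regularPart (v : ℤ) : ℝ :=
  ∫ β in 0..Real.pi, (4 * Real.sin (β / 2))⁻¹ *
    (Real.cos (v * β) / √(1 + Real.sin (β / 2) ^ 2) - Real.cos (β / 2))

theorem abs_one_sub_cos_le (v : ℝ) {β : ℝ} (h0 : 0 ≤ β) (h1 : β ≤ Real.pi) :
    |1 - Real.cos (v * β)| ≤ v ^ 2 * Real.pi ^ 2 * Real.sin (β / 2) ^ 2 := by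
  have hσ := div_pi_le_sin_half h0 h1
  have h2 : β ≤ Real.pi * Real.sin (β / 2) := by
    rwa [div_le_iff₀' Real.pi_pos] at hσ
  rw [abs_of_nonneg (by linarith [Real.cos_le_one (v * β)])]
  have h3 := Real.one_sub_sq_div_two_le_cos (x := v * β)
  have h4 : β ^ 2 ≤ (Real.pi * Real.sin (β / 2)) ^ 2 := pow_le_pow_left₀ h0 h2 2
  nlinarith [mul_le_mul_of_nonneg_left h4 (sq_nonneg v), sq_nonneg (v * β)]

theorem abs_inv_sqrt_sub_le {x δ : ℝ} (hx : 1 ≤ x) (hδ : 0 ≤ δ) :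
    |1 / √(x + δ) - 1 / √x| ≤ δ := by
  have h1 : 1 ≤ √x := Real.one_le_sqrt.2 hx
  have h2 : √x ≤ √(x + δ) := Real.sqrt_le_sqrt (by linarith)
  have h3 : √(x + δ) ^ 2 = √x ^ 2 + δ := by
    rw [Real.sq_sqrt (by linarith), Real.sq_sqrt (by linarith)]
  rw [abs_sub_comm, abs_of_nonneg (sub_nonneg.2 (one_div_le_one_div_of_le (by linarith) h2)),
    div_sub_div _ _ (by positivity) (by positivity), div_le_iff₀ (by positivity)]
  have h4 : √(x + δ) - √x ≤ δ := by nlinarith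
  have h5 : 1 ≤ √x * √(x + δ) := by nlinarith
  nlinarith

/-- Both terms are `1` up to `O(sin² (β / 2))`, so their difference cancels the singularity of `1 /
sin (β / 2)` in `regularPart`. -/
theorem exists_abs_bracket_le (v : ℤ) : ∃ C : ℝ, 0 ≤ C ∧ ∀ β : ℝ, 0 ≤ β → β ≤ Real.pi →
    |Real.cos (v * β) / √(1 + Real.sin (β / 2) ^ 2) - Real.cos (β / 2)| ≤
      C * Real.sin (β / 2) ^ 2 := by
  refine ⟨(v : ℝ) ^ 2 * Real.pi ^ 2 + 1 + (1 / 2) ^ 2 * Real.pi ^ 2, by positivity, ?_⟩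
  intro β h0 h1
  have e1 := abs_one_sub_cos_le v h0 h1
  have e2 := abs_one_sub_cos_le (1 / 2) h0 h1
  rw [show 1 / 2 * β = β / 2 by ring] at e2
  have e3 := abs_inv_sqrt_sub_le (x := 1) le_rfl (sq_nonneg (Real.sin (β / 2)))
  rw [Real.sqrt_one, div_one] at e3
  have hT : 1 ≤ √(1 + Real.sin (β / 2) ^ 2) :=
    Real.one_le_sqrt.2 (by linarith [sq_nonneg (Real.sin (β / 2))])
  have e4 : |-(1 - Real.cos (v * β)) * (1 / √(1 + Real.sin (β / 2) ^ 2))| ≤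
      (v : ℝ) ^ 2 * Real.pi ^ 2 * Real.sin (β / 2) ^ 2 := by
    rw [abs_mul, abs_neg, abs_of_pos (a := 1 / _) (by positivity)]
    refine (mul_le_of_le_one_right (abs_nonneg _) ?_).trans e1
    rw [div_le_one (by positivity)]
    exact hT
  have e5 : Real.cos (v * β) / √(1 + Real.sin (β / 2) ^ 2) - Real.cos (β / 2) =
      -(1 - Real.cos (v * β)) * (1 / √(1 + Real.sin (β / 2) ^ 2)) +
        (1 / √(1 + Real.sin (β / 2) ^ 2) - 1) + (1 - Real.cos (β / 2)) := by ring
  rw [e5]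
  refine (abs_add_three _ _ _).trans ?_
  linarith

theorem integrable_regularPart (v : ℤ) : IntervalIntegrable (fun β => (4 * Real.sin (β / 2))⁻¹ *
    (Real.cos (v * β) / √(1 + Real.sin (β / 2) ^ 2) - Real.cos (β / 2))) MeasureTheory.volume
    0 Real.pi := by
  obtain ⟨C, hC, h⟩ := exists_abs_bracket_le v
  rw [intervalIntegrable_iff_integrableOn_Ioc_of_le Real.pi_pos.le]
  refine MeasureTheory.Measure.integrableOn_of_bounded (M := C) (by simp) ?_ ?_
  · exact Measurable.aestronglyMeasurable (by fun_prop)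
  · refine (MeasureTheory.ae_restrict_iff' measurableSet_Ioc).2 (Eventually.of_forall ?_)
    intro β hβ
    have hσ := sin_half_pos hβ.1 hβ.2
    have hσ1 := Real.sin_le_one (β / 2)
    rw [Real.norm_eq_abs, abs_mul, abs_of_pos (by positivity), inv_mul_le_iff₀ (by positivity)]
    refine (h β hβ.1.le hβ.2).trans ?_
    nlinarith [mul_nonneg hC hσ.le]

/-- This comparison integrand has the singularity of the `n = 0` Green function at `β = 0`, and the
extra `cos (β / 2)` makes it exactly integrable. -/
theorem integral_cos_half_div {δ : ℝ} (hδ : 0 < δ) :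
    ∫ β in 0..Real.pi, 1 / 4 * (Real.cos (β / 2) / √(Real.sin (β / 2) ^ 2 + δ)) =
      1 / 2 * Real.arsinh (1 / √δ) := by
  have hs := Real.sqrt_pos.2 hδ
  have hpos : ∀ β : ℝ, 0 < Real.sin (β / 2) ^ 2 + δ := fun β => by positivity
  have hd : ∀ β : ℝ, HasDerivAt (fun β => 1 / 2 * Real.arsinh (Real.sin (β / 2) / √δ))
      (1 / 4 * (Real.cos (β / 2) / √(Real.sin (β / 2) ^ 2 + δ))) β := by
    intro β
    have h := (((((hasDerivAt_id β).div_const 2).sin).div_const √δ).arsinh).const_mul (1 / 2)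
    refine h.congr_deriv ?_
    have h1 : √(Real.sin (β / 2) ^ 2 + δ) = √δ * √(1 + (Real.sin (β / 2) / √δ) ^ 2) := by
      rw [← Real.sqrt_mul hδ.le, div_pow _ (√δ), Real.sq_sqrt hδ.le]
      congr 1
      field_simp
      ring
    have h2 : 0 < √(1 + (Real.sin (β / 2) / √δ) ^ 2) := Real.sqrt_pos.2 (by positivity)
    rw [h1, smul_eq_mul, id]
    field_simp
    ring
  rw [intervalIntegral.integral_eq_sub_of_hasDerivAt (fun β _ => hd β)]
  · simp
  · refine Continuous.intervalIntegrable ?_ _ _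
    exact continuous_const.mul (Continuous.div (by fun_prop) (by fun_prop)
      fun β => (Real.sqrt_pos.2 (hpos β)).ne')

theorem continuous_massiveGreen_integrand (n : ℕ) (v : ℤ) {δ : ℝ} (hδ : 0 < δ) :
    Continuous fun β : ℝ => Real.cos (v * β) * (rho (Real.sin (β / 2) ^ 2 + δ) ^ n /
    (4 * √(Real.sin (β / 2) ^ 2 + δ) * √(1 + (Real.sin (β / 2) ^ 2 + δ)))) := by
  refine Continuous.mul (by fun_prop) (Continuous.div ?_ (by fun_prop) ?_)
  · exact (continuous_rho.comp (by fun_prop)).pow n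
  · intro β
    have h1 : 0 < √(Real.sin (β / 2) ^ 2 + δ) := Real.sqrt_pos.2 (by positivity)
    have h2 : 0 < √(1 + (Real.sin (β / 2) ^ 2 + δ)) := Real.sqrt_pos.2 (by positivity)
    positivity

theorem exists_abs_massiveGreen_sub_le (v : ℤ) : ∃ C : ℝ, 0 ≤ C ∧ ∀ δ : ℝ, 0 < δ →
    |massiveGreen δ 0 v - (1 / 2 * Real.arsinh (1 / √δ) + regularPart v)| ≤ C * √δ := by
  obtain ⟨C, hC, hbr⟩ := exists_abs_bracket_le v
  refine ⟨(1 / 4 + C / 4) * Real.pi, by positivity, fun δ hδ => ?_⟩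
  have hs := Real.sqrt_pos.2 hδ
  have hpos : ∀ β : ℝ, 0 < Real.sin (β / 2) ^ 2 + δ := fun β => by positivity
  have i1 := (continuous_massiveGreen_integrand 0 v hδ).intervalIntegrable
    (μ := MeasureTheory.volume) 0 Real.pi
  have i2 : IntervalIntegrable (fun β : ℝ =>
      1 / 4 * (Real.cos (β / 2) / √(Real.sin (β / 2) ^ 2 + δ))) MeasureTheory.volume 0 Real.pi :=
    (continuous_const.mul (Continuous.div (by fun_prop) (by fun_prop)
      fun β => (Real.sqrt_pos.2 (hpos β)).ne')).intervalIntegrable _ _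
  have i3 := integrable_regularPart v
  rw [massiveGreen, regularPart, ← integral_cos_half_div hδ, ← intervalIntegral.integral_add i2 i3,
    ← intervalIntegral.integral_sub i1 (i2.add i3), ← Real.norm_eq_abs]
  refine (intervalIntegral.norm_integral_le_of_norm_le_const
    (C := (1 / 4 + C / 4) * √δ) ?_).trans_eq ?_
  · intro β hβ
    rw [Set.uIoc_of_le Real.pi_pos.le] at hβ
    have hσ := sin_half_pos hβ.1 hβ.2
    have hb := hbr β hβ.1.le hβ.2
    have hT := abs_inv_sqrt_sub_le (x := 1 + Real.sin (β / 2) ^ 2)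
      (by linarith [sq_nonneg (Real.sin (β / 2))]) hδ.le
    rw [add_assoc] at hT
    have hS2 : √(Real.sin (β / 2) ^ 2 + δ) ^ 2 = Real.sin (β / 2) ^ 2 + √δ ^ 2 := by
      rw [Real.sq_sqrt (hpos β).le, Real.sq_sqrt hδ.le]
    have hSp : 0 < √(Real.sin (β / 2) ^ 2 + δ) := Real.sqrt_pos.2 (hpos β)
    have hd2 := Real.sq_sqrt hδ.le
    set σ := Real.sin (β / 2)
    set s := √(σ ^ 2 + δ)
    set ε := √δ
    set T' := √(1 + (σ ^ 2 + δ))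
    set T := √(1 + σ ^ 2)
    have hsσ : σ ≤ s := by nlinarith
    have hsε : ε ≤ s := by nlinarith
    have hsu : s ≤ σ + ε := by nlinarith
    -- Two replacements are separated. Passing from `T'` to `T` costs at most `δ / s ≤ ε`; passing
    -- from `s⁻¹` to `σ⁻¹` costs at most `ε / σ²`, which the bound `C σ²` on the bracket absorbs.
    have key : Real.cos (v * β) * (rho (σ ^ 2 + δ) ^ 0 / (4 * s * T')) -
        (1 / 4 * (Real.cos (β / 2) / s) +
          (4 * σ)⁻¹ * (Real.cos (v * β) / T - Real.cos (β / 2))) =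
        1 / 4 * (Real.cos (v * β) * ((1 / T' - 1 / T) * s⁻¹)) +
        1 / 4 * ((Real.cos (v * β) / T - Real.cos (β / 2)) * (s⁻¹ - σ⁻¹)) := by
      rw [pow_zero, mul_inv]
      simp only [div_eq_mul_inv, mul_inv]
      ring
    rw [key, Real.norm_eq_abs]
    have b1 : |Real.cos (v * β) * ((1 / T' - 1 / T) * s⁻¹)| ≤ ε := by
      refine (abs_mul_cos_le _ _).trans ?_
      rw [abs_mul, abs_of_pos (a := s⁻¹) (by positivity), ← div_eq_mul_inv, div_le_iff₀ hSp]
      nlinarith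
    have b2 : |(Real.cos (v * β) / T - Real.cos (β / 2)) * (s⁻¹ - σ⁻¹)| ≤ C * ε := by
      rw [abs_mul, abs_sub_comm s⁻¹, abs_of_nonneg (a := σ⁻¹ - s⁻¹)
        (sub_nonneg.2 (inv_anti₀ hσ hsσ)), inv_sub_inv hσ.ne' hSp.ne']
      have : (s - σ) / (σ * s) ≤ ε / σ ^ 2 := by
        rw [div_le_div_iff₀ (by positivity) (by positivity)]
        have h1 : (s - σ) * σ ^ 2 ≤ ε * σ ^ 2 := by nlinarith [sq_nonneg σ]
        have h2 : ε * σ ^ 2 ≤ ε * (σ * s) :=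
          mul_le_mul_of_nonneg_left (by nlinarith) hs.le
        linarith
      calc _ ≤ (C * σ ^ 2) * (ε / σ ^ 2) := by
            refine mul_le_mul hb this ?_ (by positivity)
            exact div_nonneg (by linarith) (by positivity)
        _ = C * ε := by field_simp
    refine (abs_add_le _ _).trans ?_
    rw [abs_mul, abs_mul (1 / 4), abs_of_pos (a := (1 / 4 : ℝ)) (by norm_num)]
    linarith
  · rw [sub_zero, abs_of_pos Real.pi_pos]
    ring

/-! ### Difference and mean of neighbouring Green functions -/

/-- The weight of the difference `(ρⁿ - ρⁿ⁺¹) / (ρ⁻¹ - ρ)`. -/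
noncomputable def diffWeight (n : ℕ) (r : ℝ) : ℝ := r ^ n * (r / (1 + r))

/-- The weight of `(1 - (ρⁿ + ρⁿ⁺¹) / 2) / (ρ⁻¹ - ρ)`. -/
noncomputable def meanWeight (n : ℕ) (r : ℝ) : ℝ :=
  (1 / 2 * r ^ n + ∑ i ∈ Finset.range n, r ^ i) * (r / (1 + r))

theorem contDiffOn_diffWeight (n : ℕ) : ContDiffOn ℝ 1 (diffWeight n) (Set.Icc 0 1) := by
  unfold diffWeight
  refine ContDiffOn.mul (by fun_prop) (ContDiffOn.div (by fun_prop) (by fun_prop) ?_)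
  intro x hx
  have := hx.1
  positivity

theorem contDiffOn_meanWeight (n : ℕ) : ContDiffOn ℝ 1 (meanWeight n) (Set.Icc 0 1) := by
  unfold meanWeight
  refine ContDiffOn.mul (by fun_prop) (ContDiffOn.div (by fun_prop) (by fun_prop) ?_)
  intro x hx
  have := hx.1
  positivity

/-- Since `ρ⁻¹ - ρ = (1 - ρ) (1 + ρ) / ρ`, the factor `1 - ρ` of `ρⁿ - ρⁿ⁺¹` removes the singularity
at `ρ = 1`. -/
theorem massiveGreen_sub {δ : ℝ} (hδ : 0 < δ) (n : ℕ) (v : ℤ) :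
    massiveGreen δ n v - massiveGreen δ (n + 1) v = cosTransform (diffWeight n) v δ := by
  unfold massiveGreen cosTransform
  rw [← intervalIntegral.integral_sub
    ((continuous_massiveGreen_integrand n v hδ).intervalIntegrable _ _)
    ((continuous_massiveGreen_integrand (n + 1) v hδ).intervalIntegrable _ _)]
  refine intervalIntegral.integral_congr fun β _ => ?_
  have hS : 0 < Real.sin (β / 2) ^ 2 + δ := by positivity
  rw [← inv_sub_rho hS.le, diffWeight]
  have h1 := rho_pos hS.le
  have h2 := rho_lt_one hS
  set r := rho (Real.sin (β / 2) ^ 2 + δ)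
  have h3 : r⁻¹ - r = (1 - r) * (1 + r) / r := by field_simp; ring
  have h4 : 1 - r ≠ 0 := by linarith
  rw [h3]
  field_simp
  ring

/-- The mean is compared with `n = 0` because `1 - (ρⁿ + ρⁿ⁺¹) / 2` is divisible by `1 - ρ`, by the
geometric sum. The logarithmic singularity is thus the same for all `n`. -/
theorem massiveGreen_add {δ : ℝ} (hδ : 0 < δ) (n : ℕ) (v : ℤ) :
    (massiveGreen δ n v + massiveGreen δ (n + 1) v) / 2 =
      massiveGreen δ 0 v - cosTransform (meanWeight n) v δ := by
  unfold massiveGreen cosTransform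
  rw [← intervalIntegral.integral_add
    ((continuous_massiveGreen_integrand n v hδ).intervalIntegrable _ _)
    ((continuous_massiveGreen_integrand (n + 1) v hδ).intervalIntegrable _ _),
    ← intervalIntegral.integral_sub
    ((continuous_massiveGreen_integrand 0 v hδ).intervalIntegrable _ _)
    ((continuous_comp_rho (contDiffOn_meanWeight n).continuousOn v hδ.le).intervalIntegrable _ _),
    ← intervalIntegral.integral_div]
  refine intervalIntegral.integral_congr fun β _ => ?_
  have hS : 0 < Real.sin (β / 2) ^ 2 + δ := by positivity
  rw [← inv_sub_rho hS.le, meanWeight]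
  have h1 := rho_pos hS.le
  have h2 := rho_lt_one hS
  set r := rho (Real.sin (β / 2) ^ 2 + δ)
  have h3 : r⁻¹ - r = (1 - r) * (1 + r) / r := by field_simp; ring
  have h4 : 1 - r ≠ 0 := by linarith
  have hg := geom_sum_mul_neg r n
  set G := ∑ i ∈ Finset.range n, r ^ i
  rw [h3]
  field_simp
  rw [pow_succ]
  linear_combination 2 * Real.cos (v * β) * hg

theorem exists_abs_cosTransform_sub_le {P : ℝ → ℝ} (hP : ContDiffOn ℝ 1 P (Set.Icc 0 1)) (v : ℤ) :
    ∃ C : ℝ, 0 ≤ C ∧ ∀ h : ℝ, 0 < h → h ≤ 1 / 2 →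
      |cosTransform P v (h ^ 2 / (2 * (1 - h))) - cosTransform P v 0| ≤
        C * (h ^ 2 * (1 + |Real.log h|)) := by
  obtain ⟨K, hK⟩ := (hP.locallyLipschitzOn (convex_Icc 0 1)).exists_lipschitzOnWith_of_compact
    isCompact_Icc
  refine ⟨2 * Real.pi * K * 4, by positivity, fun h h0 h1 => ?_⟩
  have ha : 0 < 1 - h := by linarith
  have hδ : 0 < h ^ 2 / (2 * (1 - h)) := by positivity
  refine (abs_cosTransform_sub_le (C := K) K.2 hP.continuousOn (fun x hx y hy => ?_) v hδ).trans ?_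
  · have := hK.dist_le_mul x hx y hy
    rwa [Real.dist_eq, Real.dist_eq] at this
  · have hA := (abs_le.1 (abs_arsinh_sub_le h0 h1)).2
    have hA0 : 0 ≤ Real.arsinh (1 / √(h ^ 2 / (2 * (1 - h)))) := Real.arsinh_nonneg_iff.2 (by positivity)
    have hl : -Real.log h ≤ |Real.log h| := neg_le_abs _
    have hl2 := Real.log_two_lt_d9
    have hδh : h ^ 2 / (2 * (1 - h)) ≤ h ^ 2 := by
      rw [div_le_iff₀ (by positivity)]
      nlinarith [sq_nonneg h]
    have hA1 : Real.arsinh (1 / √(h ^ 2 / (2 * (1 - h)))) ≤ 4 * (1 + |Real.log h|) := by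
      have := abs_nonneg (Real.log h)
      linarith
    calc _ = 2 * Real.pi * K * (h ^ 2 / (2 * (1 - h)) *
          Real.arsinh (1 / √(h ^ 2 / (2 * (1 - h))))) := by ring
      _ ≤ 2 * Real.pi * K * (h ^ 2 * (4 * (1 + |Real.log h|))) := by gcongr
      _ = _ := by ring

theorem exists_abs_massiveGreen_sub_log_le (v : ℤ) : ∃ C : ℝ, 0 ≤ C ∧ ∀ h : ℝ, 0 < h → h ≤ 1 / 2 →
    |massiveGreen (h ^ 2 / (2 * (1 - h))) 0 v -
      (-(1 / 2) * Real.log h + 3 / 4 * Real.log 2 + regularPart v)| ≤ C * h := by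
  obtain ⟨C, hC, hB⟩ := exists_abs_massiveGreen_sub_le v
  refine ⟨C + 1, by positivity, fun h h0 h1 => ?_⟩
  have ha : 0 < 1 - h := by linarith
  have hδ : 0 < h ^ 2 / (2 * (1 - h)) := by positivity
  have e1 := hB _ hδ
  have e2 := abs_arsinh_sub_le h0 h1
  have e3 : √(h ^ 2 / (2 * (1 - h))) ≤ h := by
    rw [Real.sqrt_le_left h0.le, div_le_iff₀ (by positivity)]
    nlinarith [sq_nonneg h]
  have e4 := mul_le_mul_of_nonneg_left e3 hC
  rw [abs_le] at *
  constructor <;> linarith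


/-! ### The substitution `z = -ρ` and the integrals defining the coefficients -/

/-- The number `√(1 + sin² (β / 2)) - sin (β / 2)`, whose square is the small root. -/
noncomputable def rootHalf (β : ℝ) : ℝ := √(1 + Real.sin (β / 2) ^ 2) - Real.sin (β / 2)

/-- The parametrisation of `[-1, -3 + 2√2]` by `[0, π]`. -/
noncomputable def zMap (β : ℝ) : ℝ := -rootHalf β ^ 2

theorem sq_sqrt_one_add_sin_sq (β : ℝ) :
    √(1 + Real.sin (β / 2) ^ 2) ^ 2 = 1 + Real.sin (β / 2) ^ 2 := Real.sq_sqrt (by positivity)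

theorem sqrt_one_add_sin_sq_pos (β : ℝ) : 0 < √(1 + Real.sin (β / 2) ^ 2) :=
  Real.sqrt_pos.2 (by positivity)

theorem rootHalf_pos (β : ℝ) : 0 < rootHalf β := by
  have h1 := sq_sqrt_one_add_sin_sq β
  have h2 := sqrt_one_add_sin_sq_pos β
  unfold rootHalf
  nlinarith

theorem rootHalf_sq (β : ℝ) : rootHalf β ^ 2 + 2 * Real.sin (β / 2) * rootHalf β = 1 := by
  unfold rootHalf
  linear_combination sq_sqrt_one_add_sin_sq β

theorem one_add_rootHalf_sq (β : ℝ) :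
    1 + rootHalf β ^ 2 = 2 * √(1 + Real.sin (β / 2) ^ 2) * rootHalf β := by
  have : √(1 + Real.sin (β / 2) ^ 2) = rootHalf β + Real.sin (β / 2) := by unfold rootHalf; ring
  rw [this]
  linear_combination -(rootHalf_sq β)

theorem sin_half_nonneg {β : ℝ} (hβ : β ∈ Set.Icc 0 Real.pi) : 0 ≤ Real.sin (β / 2) :=
  Real.sin_nonneg_of_nonneg_of_le_pi (by linarith [hβ.1]) (by linarith [hβ.1, hβ.2])

theorem cos_half_pos {β : ℝ} (hβ : β ∈ Set.Ioo 0 Real.pi) : 0 < Real.cos (β / 2) :=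
  Real.cos_pos_of_mem_Ioo ⟨by linarith [hβ.1, Real.pi_pos], by linarith [hβ.2]⟩

theorem zMap_eq_neg_rho {β : ℝ} (hβ : β ∈ Set.Icc 0 Real.pi) :
    zMap β = -rho (Real.sin (β / 2) ^ 2 + 0) := by
  rw [zMap, rootHalf, rho, add_zero, Real.sqrt_sq (sin_half_nonneg hβ)]

theorem hasDerivAt_sqrt_one_add_sin_sq (β : ℝ) :
    HasDerivAt (fun β => √(1 + Real.sin (β / 2) ^ 2))
      (Real.sin (β / 2) * Real.cos (β / 2) / (2 * √(1 + Real.sin (β / 2) ^ 2))) β := by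
  have h := (((((hasDerivAt_id β).div_const 2).sin.pow 2).const_add 1).sqrt
    (by simp only [id, Pi.pow_apply]; positivity))
  refine h.congr_deriv ?_
  simp only [id, Pi.pow_apply]
  have := sqrt_one_add_sin_sq_pos β
  field_simp
  ring

theorem hasDerivAt_sin_half (β : ℝ) :
    HasDerivAt (fun β => Real.sin (β / 2)) (Real.cos (β / 2) / 2) β := by
  have h := ((hasDerivAt_id β).div_const 2).sin
  refine h.congr_deriv ?_
  simp only [id]
  ring

theorem hasDerivAt_cos_half (β : ℝ) :
    HasDerivAt (fun β => Real.cos (β / 2)) (-Real.sin (β / 2) / 2) β := by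
  have h := ((hasDerivAt_id β).div_const 2).cos
  refine h.congr_deriv ?_
  simp only [id]
  ring

theorem hasDerivAt_zMap (β : ℝ) : HasDerivAt zMap
    (rootHalf β ^ 2 * Real.cos (β / 2) / √(1 + Real.sin (β / 2) ^ 2)) β := by
  have h := (((hasDerivAt_sqrt_one_add_sin_sq β).sub (hasDerivAt_sin_half β)).pow 2).neg
  refine h.congr_deriv ?_
  have := sqrt_one_add_sin_sq_pos β
  simp only [rootHalf, Pi.sub_apply]
  field_simp
  ring

theorem deriv_zMap_pos {β : ℝ} (hβ : β ∈ Set.Ioo 0 Real.pi) :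
    0 < rootHalf β ^ 2 * Real.cos (β / 2) / √(1 + Real.sin (β / 2) ^ 2) := by
  have := sqrt_one_add_sin_sq_pos β
  have := rootHalf_pos β
  have := cos_half_pos hβ
  positivity

theorem continuous_zMap : Continuous zMap :=
  continuous_iff_continuousAt.2 fun β => (hasDerivAt_zMap β).continuousAt

theorem strictMonoOn_zMap : StrictMonoOn zMap (Set.Icc 0 Real.pi) := by
  refine strictMonoOn_of_deriv_pos (convex_Icc 0 Real.pi) continuous_zMap.continuousOn ?_
  intro β hβ
  rw [interior_Icc] at hβ
  rw [(hasDerivAt_zMap β).deriv]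
  exact deriv_zMap_pos hβ

theorem zMap_zero : zMap 0 = -1 := by simp [zMap, rootHalf]

theorem zMap_pi : zMap Real.pi = -3 + 2 * √2 := by
  have h : √(2 : ℝ) ^ 2 = 2 := Real.sq_sqrt (by norm_num)
  rw [zMap, rootHalf, Real.sin_pi_div_two, one_pow, one_add_one_eq_two]
  linear_combination -h

theorem image_zMap : zMap '' Set.Ioo 0 Real.pi = Set.Ioo (-1) (-3 + 2 * √2) := by
  rw [← zMap_zero, ← zMap_pi]
  refine Set.Subset.antisymm ?_ (intermediate_value_Ioo Real.pi_pos.le continuous_zMap.continuousOn)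
  rintro _ ⟨β, hβ, rfl⟩
  have h0 := Set.left_mem_Icc.2 Real.pi_pos.le
  have h1 := Set.right_mem_Icc.2 Real.pi_pos.le
  exact ⟨strictMonoOn_zMap h0 (Set.Ioo_subset_Icc_self hβ) hβ.1,
    strictMonoOn_zMap (Set.Ioo_subset_Icc_self hβ) h1 hβ.2⟩

/-- The change of variables for an injective differentiable map needs no regularity of `G`. The open
interval avoids the endpoints, where `b` (at `z = -1`) and the inverse square root (at `z = -3 +
2√2`) are singular. -/
theorem integral_eq_integral_zMap (G : ℝ → ℝ) {F : ℝ → ℝ}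
    (hF : ∀ β ∈ Set.Ioo 0 Real.pi,
      rootHalf β ^ 2 * Real.cos (β / 2) / √(1 + Real.sin (β / 2) ^ 2) * G (zMap β) = F β) :
    ∫ z in (-1)..(-3 + 2 * √2), G z = ∫ β in 0..Real.pi, F β := by
  have hle : (-1 : ℝ) ≤ -3 + 2 * √2 := by
    have := Real.one_le_sqrt.2 (one_le_two : (1 : ℝ) ≤ 2)
    linarith
  rw [intervalIntegral.integral_of_le hle, intervalIntegral.integral_of_le Real.pi_pos.le,
    MeasureTheory.integral_Ioc_eq_integral_Ioo, MeasureTheory.integral_Ioc_eq_integral_Ioo,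
    ← image_zMap, MeasureTheory.integral_image_eq_integral_abs_deriv_smul measurableSet_Ioo
      (fun β _ => (hasDerivAt_zMap β).hasDerivWithinAt)
      (strictMonoOn_zMap.injOn.mono Set.Ioo_subset_Icc_self)]
  refine MeasureTheory.setIntegral_congr_fun measurableSet_Ioo fun β hβ => ?_
  rw [abs_of_pos (deriv_zMap_pos hβ), smul_eq_mul, hF β hβ]

theorem sin_sq_add_cos_sq_half (β : ℝ) : Real.sin (β / 2) ^ 2 + Real.cos (β / 2) ^ 2 = 1 :=
  Real.sin_sq_add_cos_sq _

theorem sqrt_zMap {β : ℝ} (hβ : β ∈ Set.Ioo 0 Real.pi) :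
    √(-1 - 6 * zMap β - zMap β ^ 2) = 2 * rootHalf β * Real.cos (β / 2) := by
  have h1 := rootHalf_pos β
  have h2 := cos_half_pos hβ
  have h3 := rootHalf_sq β
  have h4 := sin_sq_add_cos_sq_half β
  rw [← Real.sqrt_sq (show 0 ≤ 2 * rootHalf β * Real.cos (β / 2) by positivity), zMap]
  congr 1
  linear_combination (1 - rootHalf β ^ 2 + 2 * Real.sin (β / 2) * rootHalf β) * h3 -
    4 * rootHalf β ^ 2 * h4

theorem cos_eq_half (β : ℝ) : Real.cos β = 1 - 2 * Real.sin (β / 2) ^ 2 := by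
  rw [sin_sq_half_eq]; ring

/-- This is `ρ + ρ⁻¹ = 2 + 4 sin² (β / 2)` rewritten for `z = -ρ`; it makes the radicand in `θ` a
perfect square. -/
theorem zMap_quadratic (β : ℝ) :
    4 * zMap β + zMap β ^ 2 + 1 = 2 * Real.cos β * zMap β := by
  rw [cos_eq_half, zMap]
  linear_combination (rootHalf β ^ 2 - 1 - 2 * Real.sin (β / 2) * rootHalf β) * rootHalf_sq β

theorem zMap_radicand (β : ℝ) :
    4 * zMap β ^ 2 - (4 * zMap β + zMap β ^ 2 + 1) ^ 2 = (2 * rootHalf β ^ 2 * Real.sin β) ^ 2 := by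
  have h := Real.sin_sq_add_cos_sq β
  rw [zMap_quadratic, zMap]
  linear_combination -(4 * rootHalf β ^ 4) * h

theorem theta_zMap {β : ℝ} (hβ : β ∈ Set.Ioo 0 Real.pi) : theta (zMap β) = -cis β := by
  have h1 := rootHalf_pos β
  have h2 := Real.sin_pos_of_mem_Ioo hβ
  have hc : (rootHalf β : ℂ) ≠ 0 := by exact_mod_cast h1.ne'
  have h3 : 4 * (zMap β : ℂ) + (zMap β : ℂ) ^ 2 + 1 = 2 * Real.cos β * zMap β := by
    exact_mod_cast zMap_quadratic β
  rw [theta, zMap_radicand, Real.sqrt_sq (by positivity), h3, zMap, cis, Complex.exp_mul_I]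
  push_cast
  field_simp
  ring

theorem kFun_zMap (v : ℤ) {β : ℝ} (hβ : β ∈ Set.Ioo 0 Real.pi) :
    kFun v (zMap β) = (-1) ^ v * Real.cos (v * β) := by
  have h : ((theta (zMap β) ^ v + theta (zMap β) ^ (-v)) / 2) =
      (((-1) ^ v * Real.cos (v * β) : ℝ) : ℂ) := by
    have h1 : ((-1 : ℂ)) ^ (-v) = (-1) ^ v := by
      rw [zpow_neg, ← inv_zpow, inv_neg_one]
    have h3 := cis_add_inv (v * β)
    rw [theta_zMap hβ, neg_eq_neg_one_mul, mul_zpow, mul_zpow, h1, cis_zpow, cis_zpow,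
      show (((-v : ℤ) : ℝ) * β) = -(v * β) by push_cast; ring, cis_neg]
    push_cast at h3 ⊢
    linear_combination (-1) ^ v / 2 * h3
  rw [kFun, h, Complex.ofReal_re]

/-- Needed to apply the chain rule to `kFun v ∘ zMap`. It holds because the radicand in `θ` is
positive for `0 < β < π`. -/
theorem differentiableAt_kFun (v : ℤ) {β : ℝ} (hβ : β ∈ Set.Ioo 0 Real.pi) :
    DifferentiableAt ℝ (kFun v) (zMap β) := by
  have h1 := rootHalf_pos β
  have h2 := Real.sin_pos_of_mem_Ioo hβ
  have h0 : (zMap β : ℂ) ≠ 0 := by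
    have : zMap β ≠ 0 := by rw [zMap]; exact (neg_neg_of_pos (by positivity)).ne
    exact_mod_cast this
  have hid : DifferentiableAt ℝ (fun z : ℝ => (z : ℂ)) (zMap β) :=
    Complex.ofRealCLM.differentiableAt
  have hsq : DifferentiableAt ℝ (fun z : ℝ => √(4 * z ^ 2 - (4 * z + z ^ 2 + 1) ^ 2)) (zMap β) := by
    refine DifferentiableAt.sqrt (by fun_prop) ?_
    rw [zMap_radicand]
    positivity
  have hsqc : DifferentiableAt ℝ
      (fun z : ℝ => ((√(4 * z ^ 2 - (4 * z + z ^ 2 + 1) ^ 2) : ℝ) : ℂ)) (zMap β) :=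
    Complex.ofRealCLM.differentiableAt.comp (zMap β) hsq
  have hθ : DifferentiableAt ℝ theta (zMap β) := by
    unfold theta
    refine DifferentiableAt.mul ?_ (by fun_prop)
    exact DifferentiableAt.div (by fun_prop) (by fun_prop) (mul_ne_zero two_ne_zero h0)
  have hθ0 : theta (zMap β) ≠ 0 := by
    rw [theta_zMap hβ]; exact neg_ne_zero.2 (cis_ne_zero β)
  have hz : ∀ n : ℤ, DifferentiableAt ℝ (fun z => theta z ^ n) (zMap β) := fun n =>
    ((differentiableAt_zpow.2 (Or.inl hθ0) : DifferentiableAt ℂ (fun w => w ^ n)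
      (theta (zMap β))).restrictScalars ℝ).comp (zMap β) hθ
  have hk : DifferentiableAt ℝ (fun z => (theta z ^ v + theta z ^ (-v)) / 2) (zMap β) :=
    ((hz v).add (hz (-v))).div_const 2
  exact Complex.reCLM.differentiableAt.comp (zMap β) hk

theorem deriv_kFun_zMap (v : ℤ) {β : ℝ} (hβ : β ∈ Set.Ioo 0 Real.pi) :
    rootHalf β ^ 2 * Real.cos (β / 2) / √(1 + Real.sin (β / 2) ^ 2) * deriv (kFun v) (zMap β) =
      -((-1) ^ v * (v * Real.sin (v * β))) := by
  have h1 := (differentiableAt_kFun v hβ).hasDerivAt.comp β (hasDerivAt_zMap β)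
  have h2 : HasDerivAt (fun β : ℝ => (-1) ^ v * Real.cos (v * β))
      (-((-1) ^ v * (v * Real.sin (v * β)))) β := by
    refine (((hasDerivAt_id β).const_mul (v : ℝ)).cos.const_mul _).congr_deriv ?_
    simp only [id]
    ring
  have h3 : (fun β : ℝ => (-1) ^ v * Real.cos (v * β)) =ᶠ[nhds β] kFun v ∘ zMap := by
    filter_upwards [isOpen_Ioo.mem_nhds hβ] with t ht
    exact (kFun_zMap v ht).symm
  rw [mul_comm]
  exact h1.unique (h2.congr_of_eventuallyEq h3.symm)

theorem bFun_zMap {β : ℝ} (hβ : β ∈ Set.Ioo 0 Real.pi) :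
    bFun (zMap β) = -(1 / 2) * (Real.log (4 * √2) + Real.log (Real.sin (β / 2)) -
      Real.log (√(1 + Real.sin (β / 2) ^ 2) + Real.cos (β / 2))) := by
  have h1 := rootHalf_pos β
  have h2 := cos_half_pos hβ
  have h3 := sqrt_one_add_sin_sq_pos β
  have h4 := sin_half_pos hβ.1 hβ.2.le
  have h5 : 4 * √2 * (1 + zMap β) / (1 - zMap β + √(-1 - 6 * zMap β - zMap β ^ 2)) =
      4 * √2 * Real.sin (β / 2) / (√(1 + Real.sin (β / 2) ^ 2) + Real.cos (β / 2)) := by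
    have e1 : 1 + zMap β = 2 * Real.sin (β / 2) * rootHalf β := by
      rw [zMap]; linear_combination -(rootHalf_sq β)
    have e2 : 1 - zMap β = 2 * √(1 + Real.sin (β / 2) ^ 2) * rootHalf β := by
      rw [zMap, ← one_add_rootHalf_sq]; ring
    rw [sqrt_zMap hβ, e1, e2]
    field_simp
  rw [bFun, h5, Real.log_div (by positivity) (by positivity),
    Real.log_mul (by positivity) h4.ne']

/-- The Jacobian divided by the square root is `ρ / (1 + ρ)`, the factor common to `diffWeight` and
`meanWeight`. -/
theorem weight_zMap {β : ℝ} (hβ : β ∈ Set.Ioo 0 Real.pi) :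
    rootHalf β ^ 2 * Real.cos (β / 2) / √(1 + Real.sin (β / 2) ^ 2) /
      √(-1 - 6 * zMap β - zMap β ^ 2) = -zMap β / (1 + -zMap β) := by
  have h1 := rootHalf_pos β
  have h2 := cos_half_pos hβ
  have h3 := sqrt_one_add_sin_sq_pos β
  rw [sqrt_zMap hβ, zMap, neg_neg, one_add_rootHalf_sq]
  field_simp

theorem integral_kFun_div_sqrt (P : ℝ → ℝ) (v : ℤ) :
    ∫ z in (-1)..(-3 + 2 * √2), P (-z) * (kFun v z / √(-1 - 6 * z - z ^ 2)) =
      (-1) ^ v * cosTransform (fun r => P r * (r / (1 + r))) v 0 := by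
  rw [cosTransform, ← intervalIntegral.integral_const_mul]
  refine integral_eq_integral_zMap _ fun β hβ => ?_
  have h := weight_zMap hβ
  rw [kFun_zMap v hβ]
  have h2 : rho (Real.sin (β / 2) ^ 2 + 0) = -zMap β := by
    rw [zMap_eq_neg_rho (Set.Ioo_subset_Icc_self hβ), neg_neg]
  rw [h2, ← h]
  ring

theorem integral_deriv_kFun_mul_bFun (v : ℤ) :
    ∫ z in (-1)..(-3 + 2 * √2), deriv (kFun v) z * bFun z =
      (-1) ^ v * ∫ β in 0..Real.pi, v * Real.sin (v * β) * (1 / 2 * (Real.log (4 * √2) +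
        Real.log (Real.sin (β / 2)) -
          Real.log (√(1 + Real.sin (β / 2) ^ 2) + Real.cos (β / 2)))) := by
  rw [← intervalIntegral.integral_const_mul]
  refine integral_eq_integral_zMap _ fun β hβ => ?_
  rw [← mul_assoc, deriv_kFun_zMap v hβ, bFun_zMap hβ]
  ring

theorem sqrt_add_cos_half_pos {β : ℝ} (hβ : β ∈ Set.Icc 0 Real.pi) :
    0 < √(1 + Real.sin (β / 2) ^ 2) + Real.cos (β / 2) :=
  add_pos_of_pos_of_nonneg (sqrt_one_add_sin_sq_pos β)
    (Real.cos_nonneg_of_mem_Icc ⟨by linarith [hβ.1, Real.pi_pos], by linarith [hβ.2]⟩)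

theorem continuousOn_log_sqrt_add_cos :
    ContinuousOn (fun β => Real.log (√(1 + Real.sin (β / 2) ^ 2) + Real.cos (β / 2)))
      (Set.Icc 0 Real.pi) :=
  ContinuousOn.log (by fun_prop) fun _ hβ => (sqrt_add_cos_half_pos hβ).ne'

theorem intervalIntegrable_log_sin_half :
    IntervalIntegrable (fun β => Real.log (Real.sin (β / 2))) MeasureTheory.volume 0 Real.pi := by
  have h : IntervalIntegrable (Real.log ∘ Real.sin) MeasureTheory.volume 0 (Real.pi / 2) :=
    intervalIntegrable_log_sin
  have h2 := h.comp_mul_left (c := 1 / 2)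
  rw [zero_div, div_div_eq_mul_div, div_one, div_mul_cancel₀ _ two_ne_zero] at h2
  refine h2.congr fun β _ => ?_
  simp only [Function.comp_apply]
  congr 2
  ring

/-- The factor `cos (v β) - 1 = O(sin² (β / 2))` beats the logarithm at `0`. This continuity up to
the endpoint is what the fundamental theorem of calculus requires of the antiderivative of
`regularPart`. -/
theorem continuousOn_cos_sub_one_mul_log (v : ℤ) :
    ContinuousOn (fun β => (Real.cos (v * β) - 1) * Real.log (Real.sin (β / 2)))
      (Set.Icc 0 Real.pi) := by
  intro β hβ
  rcases hβ.1.eq_or_lt with h | h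
  · subst h
    have hg : Continuous fun β : ℝ => (v : ℝ) ^ 2 * Real.pi ^ 2 * (|Real.sin (β / 2)| *
        |Real.sin (β / 2) * Real.log (Real.sin (β / 2))|) := by
      have := Real.continuous_mul_log.comp (by fun_prop : Continuous fun β : ℝ => Real.sin (β / 2))
      exact continuous_const.mul ((by fun_prop : Continuous fun β : ℝ => |Real.sin (β / 2)|).mul
        this.abs)
    have hg0 := (hg.tendsto 0).mono_left (nhdsWithin_le_nhds (s := Set.Icc 0 Real.pi))
    simp only [zero_div, Real.sin_zero, abs_zero, zero_mul, mul_zero] at hg0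
    have hz : (Real.cos (v * 0) - 1) * Real.log (Real.sin (0 / 2)) = 0 := by simp
    rw [ContinuousWithinAt, hz]
    refine squeeze_zero_norm' ?_ hg0
    filter_upwards [self_mem_nhdsWithin] with t ht
    have hb := abs_one_sub_cos_le v ht.1 ht.2
    rw [Real.norm_eq_abs, abs_mul, abs_sub_comm, abs_mul (Real.sin _), ← mul_assoc |Real.sin _|,
      abs_mul_abs_self, ← pow_two, ← mul_assoc]
    exact mul_le_mul_of_nonneg_right hb (abs_nonneg _)
  · have := (sin_half_pos h hβ.2).ne'
    refine ContinuousAt.continuousWithinAt (ContinuousAt.mul (by fun_prop) ?_)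
    exact ContinuousAt.log (by fun_prop) this

theorem regularPart_eq_integral (v : ℤ) :
    regularPart v = (-1) ^ v * Real.log 2 - 3 / 4 * Real.log 2 -
      ∫ β in 0..Real.pi, v * Real.sin (v * β) * -(1 / 2 * (Real.log (4 * √2) +
        Real.log (Real.sin (β / 2)) -
          Real.log (√(1 + Real.sin (β / 2) ^ 2) + Real.cos (β / 2)))) := by
  have hπ := Real.pi_pos
  have hint : IntervalIntegrable (fun β => v * Real.sin (v * β) * -(1 / 2 * (Real.log (4 * √2) +
        Real.log (Real.sin (β / 2)) -
          Real.log (√(1 + Real.sin (β / 2) ^ 2) + Real.cos (β / 2)))))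
      MeasureTheory.volume 0 Real.pi := by
    refine IntervalIntegrable.continuousOn_mul ?_ (by fun_prop)
    refine (IntervalIntegrable.const_mul ?_ (1 / 2)).neg
    refine (intervalIntegrable_const.add intervalIntegrable_log_sin_half).sub ?_
    refine ContinuousOn.intervalIntegrable ?_
    rw [Set.uIcc_of_le hπ.le]
    exact continuousOn_log_sqrt_add_cos
  have hreg := integrable_regularPart v
  -- Integration by parts through an explicit antiderivative. The `-1` beside the cosine tames the
  -- logarithm at `0` and accounts for the subtracted `cos (β / 2)`. The boundary values are `(-1)^v
  -- log 2` at `π` and `(3/4) log 2` at `0`.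
  have hF := intervalIntegral.integral_eq_sub_of_hasDerivAt_of_le hπ.le
    (f := fun β => 1 / 2 * ((Real.cos (v * β) - 1) * Real.log (Real.sin (β / 2))) +
      1 / 2 * (Real.cos (v * β) * (Real.log (4 * √2) -
        Real.log (√(1 + Real.sin (β / 2) ^ 2) + Real.cos (β / 2))))) ?_ ?_ (hreg.add hint)
  · rw [intervalIntegral.integral_add hreg hint] at hF
    have hl : Real.log (4 * √2) = 5 / 2 * Real.log 2 := by
      rw [Real.log_mul (by norm_num) (by positivity), Real.log_sqrt (by norm_num),
        show (4 : ℝ) = 2 ^ 2 by norm_num, Real.log_pow]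
      push_cast
      ring
    have hcv : Real.cos (v * Real.pi) = (-1) ^ v := Real.cos_int_mul_pi v
    rw [regularPart, eq_sub_iff_add_eq, hF]
    simp only [hcv, mul_zero, Real.cos_zero, zero_div, Real.sin_zero, Real.sin_pi_div_two,
      Real.cos_pi_div_two, one_pow, add_zero, Real.log_one, sub_self, zero_mul, zero_add, hl]
    rw [one_add_one_eq_two, Real.log_sqrt (by norm_num)]
    norm_num
    ring
  · refine ContinuousOn.add (continuousOn_const.mul (continuousOn_cos_sub_one_mul_log v)) ?_
    exact continuousOn_const.mul (ContinuousOn.mul (by fun_prop)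
      (continuousOn_const.sub continuousOn_log_sqrt_add_cos))
  · intro β hβ
    have hσ := sin_half_pos hβ.1 hβ.2.le
    have hc := cos_half_pos hβ
    have hT := sqrt_one_add_sin_sq_pos β
    have hcv : HasDerivAt (fun β : ℝ => Real.cos (v * β)) (-(v * Real.sin (v * β))) β := by
      refine ((hasDerivAt_id β).const_mul (v : ℝ)).cos.congr_deriv ?_
      simp only [id]
      ring
    have h1 := ((hcv.sub_const 1).mul ((hasDerivAt_sin_half β).log hσ.ne')).const_mul (1 / 2)
    have h2 := (hcv.mul ((((hasDerivAt_sqrt_one_add_sin_sq β).add (hasDerivAt_cos_half β)).log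
      (sqrt_add_cos_half_pos (Set.Ioo_subset_Icc_self hβ)).ne').const_sub (Real.log (4 * √2)))).const_mul (1 / 2)
    refine (h1.add h2).congr_deriv ?_
    have hT2 := sq_sqrt_one_add_sin_sq β
    have hc2 := sin_sq_add_cos_sq_half β
    simp only [Pi.add_apply]
    set T := √(1 + Real.sin (β / 2) ^ 2)
    set σ := Real.sin (β / 2)
    set c := Real.cos (β / 2)
    have key : c / 2 / σ - (σ * c / (2 * T) + -σ / 2) / (T + c) = (2 * σ)⁻¹ / T := by
      field_simp
      linear_combination c * hT2 + T * hc2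
    linear_combination 1 / 2 * Real.cos (v * β) * key

theorem regularPart_eq (v : ℤ) :
    regularPart v + 3 / 4 * Real.log 2 = (-1) ^ v * (Real.log 2 +
      ∫ z in (-1)..(-3 + 2 * √2), deriv (kFun v) z * bFun z) := by
  have hs : ((-1 : ℝ) ^ v) * (-1) ^ v = 1 := by
    rw [← mul_zpow]; simp
  rw [integral_deriv_kFun_mul_bFun, regularPart_eq_integral, mul_add, ← mul_assoc, hs, one_mul]
  simp only [mul_neg, intervalIntegral.integral_neg]
  ring

theorem c0Odd_eq {p : ℤ} {n : ℕ} (hp : p.natAbs = 2 * n + 1) (v : ℤ) :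
    c0Odd p (2 * v) = (-1) ^ n * (-1) ^ v / Real.pi * cosTransform (diffWeight n) v 0 := by
  have h1 : (p.natAbs - 1) / 2 = n := by omega
  have h2 : 2 * v / 2 = v := by omega
  have h := integral_kFun_div_sqrt (fun r => (-1) ^ n * r ^ n) v
  have h3 : cosTransform (fun r => (-1) ^ n * r ^ n * (r / (1 + r))) v 0 =
      (-1) ^ n * cosTransform (diffWeight n) v 0 := by
    rw [cosTransform, cosTransform, ← intervalIntegral.integral_const_mul]
    refine intervalIntegral.integral_congr fun β _ => ?_
    simp only [diffWeight]
    ring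
  rw [h3] at h
  have h4 : ∀ z : ℝ, (-1) ^ n * (-z) ^ n = z ^ n := fun z => by
    rw [← mul_pow, neg_one_mul, neg_neg]
  simp only [h4] at h
  rw [c0Odd, h1, h2]
  simp only [mul_div_assoc]
  rw [h]
  ring

theorem c2Odd_eq {p : ℤ} {n : ℕ} (hp : p.natAbs = 2 * n + 1) (v : ℤ) :
    c2Odd p (2 * v) = 1 / Real.pi * (cosTransform (meanWeight n) v 0 -
      (regularPart v + 3 / 4 * Real.log 2)) := by
  have h1 : (p.natAbs - 1) / 2 = n := by omega
  have h2 : 2 * v / 2 = v := by omega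
  have hs : ((-1 : ℝ) ^ v) * (-1) ^ v = 1 := by
    rw [← mul_zpow]; simp
  have h := integral_kFun_div_sqrt (fun r => 1 / 2 * r ^ n + ∑ i ∈ Finset.range n, r ^ i) v
  have h3 : cosTransform (fun r => (1 / 2 * r ^ n + ∑ i ∈ Finset.range n, r ^ i) *
      (r / (1 + r))) v 0 = cosTransform (meanWeight n) v 0 := rfl
  rw [h3] at h
  rw [c2Odd, h1, h2, h, regularPart_eq]
  linear_combination 1 / Real.pi * cosTransform (meanWeight n) v 0 * hs


/-! ### First-order expansion of the combination -/

/-- The coefficient of `h`, up to the factor `π`, in the mean of two neighbouring Green functions. -/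
noncomputable def meanCoeff (n : ℕ) (v : ℤ) : ℝ :=
  cosTransform (meanWeight n) v 0 - (regularPart v + 3 / 4 * Real.log 2)

theorem exists_abs_massiveGreen_combination_le (n : ℕ) (v : ℤ) : ∃ C : ℝ, 0 ≤ C ∧
    ∀ h : ℝ, 0 < h → h ≤ 1 / 2 → ∀ s : ℝ, |s| = 1 →
      |(1 + h / (2 * (1 - h))) * (massiveGreen (h ^ 2 / (2 * (1 - h))) n v -
          massiveGreen (h ^ 2 / (2 * (1 - h))) (n + 1) v) -
        s * (h / (1 - h)) * ((massiveGreen (h ^ 2 / (2 * (1 - h))) n v +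
          massiveGreen (h ^ 2 / (2 * (1 - h))) (n + 1) v) / 2) -
        ((1 + h / 2) * cosTransform (diffWeight n) v 0 +
          s * (1 / 2 * h * Real.log h + meanCoeff n v * h))| ≤
        C * (h ^ 2 * (1 + |Real.log h|)) := by
  obtain ⟨C₁, hC₁, h₁⟩ := exists_abs_cosTransform_sub_le (contDiffOn_diffWeight n) v
  obtain ⟨C₂, hC₂, h₂⟩ := exists_abs_massiveGreen_sub_log_le v
  obtain ⟨C₃, hC₃, h₃⟩ := exists_abs_cosTransform_sub_le (contDiffOn_meanWeight n) v
  refine ⟨2 * C₁ + |cosTransform (diffWeight n) v 0| + 2 * (C₂ + C₃) +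
    2 * (1 + |meanCoeff n v|), by positivity, fun h h0 h1 s hs => ?_⟩
  have ha : 0 < 1 - h := by linarith
  have hδ : 0 < h ^ 2 / (2 * (1 - h)) := by positivity
  have b₁ := h₁ h h0 h1
  have b₂ := h₂ h h0 h1
  have b₃ := h₃ h h0 h1
  rw [massiveGreen_sub hδ, massiveGreen_add hδ]
  set δ := h ^ 2 / (2 * (1 - h)) with hδd
  set D := cosTransform (diffWeight n) v δ
  set D₀ := cosTransform (diffWeight n) v 0
  set W := cosTransform (meanWeight n) v δ
  set g := massiveGreen δ 0 v
  have hM : cosTransform (meanWeight n) v 0 = meanCoeff n v + (regularPart v + 3 / 4 * Real.log 2) := by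
    rw [meanCoeff]; ring
  rw [hM] at b₃
  set M := meanCoeff n v
  set l := Real.log h
  set E := h ^ 2 * (1 + |l|) with hE
  have hl := abs_nonneg l
  have hE1 : h ^ 2 ≤ E := le_mul_of_one_le_right (by positivity) (by linarith)
  have hE0 : 0 ≤ E := by positivity
  have a1 : 0 ≤ h / (1 - h) := by positivity
  have a2 : h / (1 - h) ≤ 2 * h := by
    rw [div_le_iff₀ ha]
    nlinarith
  have a3 : h / (1 - h) - h = h ^ 2 / (1 - h) := by field_simp; ring
  have a4 : h ^ 2 / (1 - h) ≤ 2 * h ^ 2 := by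
    rw [div_le_iff₀ ha]
    nlinarith [sq_nonneg h]
  have a5 : h / (2 * (1 - h)) = h / (1 - h) / 2 := by rw [mul_comm, ← div_div]
  have a6 : 0 ≤ h ^ 2 / (1 - h) := by positivity
  -- Each term on the right is already second order up to a logarithm: `D - D₀`, the error `h / (1 -
  -- h) - h = h² / (1 - h)`, and `h` times the `O(h)` error of the mean.
  have key : (1 + h / (2 * (1 - h))) * D - s * (h / (1 - h)) * (g - W) -
      ((1 + h / 2) * D₀ + s * (1 / 2 * h * l + M * h)) =
      (1 + h / (1 - h) / 2) * (D - D₀) + h ^ 2 / (1 - h) / 2 * D₀ +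
      (-s) * (h / (1 - h) * ((g - W) - (-(1 / 2) * l - M)) +
        h ^ 2 / (1 - h) * (-(1 / 2) * l - M)) := by
    rw [a5, ← a3]; ring
  rw [key]
  have c1 : |(1 + h / (1 - h) / 2) * (D - D₀)| ≤ 2 * (C₁ * E) := by
    rw [abs_mul, abs_of_pos (by positivity)]
    exact mul_le_mul (by linarith) b₁ (abs_nonneg _) (by norm_num)
  have c2 : |h ^ 2 / (1 - h) / 2 * D₀| ≤ E * |D₀| := by
    rw [abs_mul, abs_of_nonneg (by positivity)]
    exact mul_le_mul_of_nonneg_right (by linarith) (abs_nonneg _)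
  have c3 : |(g - W) - (-(1 / 2) * l - M)| ≤ C₂ * h + C₃ * E := by
    rw [abs_le] at b₂ b₃ ⊢
    constructor <;> linarith [b₂.1, b₂.2, b₃.1, b₃.2]
  have c4 : |h / (1 - h) * ((g - W) - (-(1 / 2) * l - M))| ≤ 2 * (C₂ + C₃) * E := by
    rw [abs_mul, abs_of_nonneg a1]
    have := mul_le_mul a2 c3 (abs_nonneg _) (by positivity)
    refine this.trans ?_
    have e1 : C₂ * h ^ 2 ≤ C₂ * E := mul_le_mul_of_nonneg_left hE1 hC₂
    have e2 : h * (C₃ * E) ≤ 1 * (C₃ * E) :=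
      mul_le_mul_of_nonneg_right (by linarith) (by positivity)
    linarith
  have c5 : |h ^ 2 / (1 - h) * (-(1 / 2) * l - M)| ≤ 2 * (1 + |M|) * E := by
    rw [abs_mul, abs_of_nonneg a6]
    have e1 : |-(1 / 2) * l - M| ≤ (1 + |M|) * (1 + |l|) := by
      refine (abs_sub _ _).trans ?_
      rw [abs_mul, abs_neg, abs_of_pos (by norm_num : (0 : ℝ) < 1 / 2)]
      nlinarith [abs_nonneg M, mul_nonneg (abs_nonneg M) hl]
    refine (mul_le_mul a4 e1 (abs_nonneg _) (by positivity)).trans_eq ?_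
    rw [hE]; ring
  refine (abs_add_three _ _ _).trans ?_
  rw [abs_mul (-s), abs_neg, hs, one_mul]
  have c6 := abs_add_le (h / (1 - h) * ((g - W) - (-(1 / 2) * l - M)))
    (h ^ 2 / (1 - h) * (-(1 / 2) * l - M))
  linarith

/-- The first-order expansion of `𝕂⁻¹` in `h`, up to the phase, in lattice coordinates. -/
noncomputable def expansion (h c : ℝ) (sgn : ℝ) (c' : ℝ) : ℝ :=
  c + c * h / 2 + sgn * (1 / (2 * Real.pi) * h * Real.log h + c' * h)

theorem abs_neg_one_zpow (n : ℤ) : |(-1 : ℝ) ^ n| = 1 := by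
  rcases Int.even_or_odd n with h | h <;> simp [h.neg_one_zpow]

theorem exists_norm_latticeGreen_combination_le (k l : ℤ) : ∃ C : ℝ, 0 ≤ C ∧
    ∀ h : ℝ, 0 < h → h ≤ 1 / 2 → ∀ p : ℤ, p.natAbs = (2 * k + 1).natAbs →
      ‖1 / (4 * (Real.pi : ℂ) ^ 2) *
          (((1 - h : ℝ) : ℂ) * latticeGreen (1 - h) k l + latticeGreen (1 - h) (k + 1) l) -
        (expansion h (c0Odd p (2 * l)) ((-1) ^ (k + l)) (c2Odd p (2 * l)) : ℝ)‖ ≤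
        C * (h ^ 2 * (1 + |Real.log h|)) := by
  -- In both cases `|2 k + 1| = 2 n + 1`, but for `k = -n - 1` the two Green functions trade places.
  -- This corresponds to `s = -1` below: the sign of `c₀` relative to `(-1) ^ (k + l)` flips, that
  -- of the other terms does not.
  obtain ⟨n, hn⟩ : ∃ n : ℕ, k = n ∨ k = -n - 1 := by
    rcases le_or_gt 0 k with h | h
    · exact ⟨k.toNat, Or.inl (by omega)⟩
    · exact ⟨(-k - 1).toNat, Or.inr (by omega)⟩
  obtain ⟨C, hC, hmain⟩ := exists_abs_massiveGreen_combination_le n l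
  have hπ := Real.pi_pos
  have hπc : (Real.pi : ℂ) ≠ 0 := by exact_mod_cast hπ.ne'
  refine ⟨1 / Real.pi * C, by positivity, fun h h0 h1 p hp => ?_⟩
  have ha : 0 < 1 - h := by linarith
  have ha' : 1 - h < 1 := by linarith
  have hpn : p.natAbs = 2 * n + 1 := by omega
  have hδ : (1 - (1 - h)) ^ 2 / (2 * (1 - h)) = h ^ 2 / (2 * (1 - h)) := by
    rw [sub_sub_cancel]
  rw [latticeGreen_eq ha ha', latticeGreen_eq ha ha', hδ, c0Odd_eq hpn, c2Odd_eq hpn,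
    ← meanCoeff, expansion]
  have hm := hmain h h0 h1
  set δ := h ^ 2 / (2 * (1 - h))
  set D₀ := cosTransform (diffWeight n) l 0
  set M := meanCoeff n l
  have hreal : ∀ g₁ g₂ : ℝ, 1 / (4 * (Real.pi : ℂ) ^ 2) * (((1 - h : ℝ) : ℂ) *
      ((4 * Real.pi / (1 - h) * ((-1) ^ (k + l) * g₁) : ℝ) : ℂ) +
      ((4 * Real.pi / (1 - h) * ((-1) ^ (k + 1 + l) * g₂) : ℝ) : ℂ)) =
      ((1 / Real.pi * (-1) ^ (k + l) * (g₁ - g₂ / (1 - h)) : ℝ) : ℂ) := by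
    intro g₁ g₂
    have hac : (1 - (h : ℂ)) ≠ 0 := by exact_mod_cast ha.ne'
    rw [add_right_comm, zpow_add_one₀ (by norm_num)]
    push_cast
    field_simp
    ring
  rw [hreal, ← Complex.ofReal_sub, Complex.norm_real, Real.norm_eq_abs]
  have hsgn : ((-1 : ℝ)) ^ (n : ℕ) = (-1) ^ (n : ℤ) := (zpow_natCast _ _).symm
  rcases hn with hk | hk
  · have e1 : k.natAbs = n := by omega
    have e2 : (k + 1).natAbs = n + 1 := by omega
    have hm1 := hm 1 abs_one
    rw [e1, e2, hsgn, ← zpow_add₀ (by norm_num), ← hk]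
    set g₁ := massiveGreen δ n l
    set g₂ := massiveGreen δ (n + 1) l
    have key : 1 / Real.pi * (-1) ^ (k + l) * (g₁ - g₂ / (1 - h)) -
        ((-1) ^ (k + l) / Real.pi * D₀ + (-1) ^ (k + l) / Real.pi * D₀ * h / 2 +
          (-1) ^ (k + l) * (1 / (2 * Real.pi) * h * Real.log h + 1 / Real.pi * M * h)) =
        (-1) ^ (k + l) * (1 / Real.pi) * ((1 + h / (2 * (1 - h))) * (g₁ - g₂) -
          1 * (h / (1 - h)) * ((g₁ + g₂) / 2) - ((1 + h / 2) * D₀ +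
          1 * (1 / 2 * h * Real.log h + M * h))) := by
      generalize (-1 : ℝ) ^ (k + l) = s
      field_simp
      ring
    rw [key, abs_mul, abs_mul, abs_neg_one_zpow, one_mul, abs_of_pos (by positivity),
      mul_assoc (1 / Real.pi) C]
    exact mul_le_mul_of_nonneg_left hm1 (by positivity)
  · have e1 : k.natAbs = n + 1 := by omega
    have e2 : (k + 1).natAbs = n := by omega
    have hm1 := hm (-1) (by simp)
    have hk2 : (-1 : ℝ) ^ (n : ℤ) * (-1) ^ l = -(-1) ^ (k + l) := by
      have : k + l = -(n + 1 : ℤ) + l := by omega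
      rw [this, zpow_add₀ (by norm_num), zpow_neg, ← inv_zpow, inv_neg_one,
        zpow_add_one₀ (by norm_num)]
      ring
    rw [e1, e2, hsgn, hk2]
    set g₁ := massiveGreen δ n l
    set g₂ := massiveGreen δ (n + 1) l
    have key : 1 / Real.pi * (-1) ^ (k + l) * (g₂ - g₁ / (1 - h)) -
        (-(-1) ^ (k + l) / Real.pi * D₀ + -(-1) ^ (k + l) / Real.pi * D₀ * h / 2 +
          (-1) ^ (k + l) * (1 / (2 * Real.pi) * h * Real.log h + 1 / Real.pi * M * h)) =
        (-1) ^ (k + l) * (1 / Real.pi) * -((1 + h / (2 * (1 - h))) * (g₁ - g₂) -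
          -1 * (h / (1 - h)) * ((g₁ + g₂) / 2) - ((1 + h / 2) * D₀ +
          -1 * (1 / 2 * h * Real.log h + M * h))) := by
      generalize (-1 : ℝ) ^ (k + l) = s
      field_simp
      ring
    rw [key, abs_mul, abs_mul, abs_neg_one_zpow, one_mul, abs_of_pos (by positivity), abs_neg,
      mul_assoc (1 / Real.pi) C]
    exact mul_le_mul_of_nonneg_left hm1 (by positivity)

/-! ### From white and black vertices to lattice coordinates -/

theorem latticeGreen_neg {a : ℝ} (ha : 0 < a) (ha' : a < 1) (u v : ℤ) :
    latticeGreen a (-u) v = latticeGreen a u v := by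
  have h : ((-1 : ℝ)) ^ (-u) = (-1) ^ u := by rw [zpow_neg, ← inv_zpow, inv_neg_one]
  rw [latticeGreen_eq ha ha', latticeGreen_eq ha ha', Int.natAbs_neg, zpow_add₀ (by norm_num),
    zpow_add₀ (by norm_num), h]

theorem sigmaPhase_eq_one {x y : ℤ × ℤ} {k l : ℤ} (h1 : y.1 - x.1 = 2 * k + 1 - 2 * l)
    (h2 : y.2 - x.2 = 2 * k + 1 + 2 * l) : sigmaPhase x y = 1 := by
  rw [sigmaPhase, if_pos]
  refine ⟨k, l, Prod.ext ?_ ?_⟩ <;> simp [e1, e2] <;> omega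

theorem sigmaPhase_eq_I {x y : ℤ × ℤ} {k l : ℤ} (h1 : y.1 - x.1 = 2 * k - (2 * l + 1))
    (h2 : y.2 - x.2 = 2 * k + (2 * l + 1)) : sigmaPhase x y = Complex.I := by
  rw [sigmaPhase, if_neg, if_pos]
  · refine ⟨k, l, Prod.ext ?_ ?_⟩ <;> simp [e1, e2] <;> omega
  · rintro ⟨k', l', h⟩
    have := congrArg Prod.fst h
    have := congrArg Prod.snd h
    simp [e1, e2] at *
    omega

theorem symmetrize_of_odd_even (F : ℤ → ℤ → ℝ) {d : ℤ × ℤ} {k l : ℤ}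
    (h1 : d.1 = 2 * k + 1 - 2 * l) (h2 : d.2 = 2 * k + 1 + 2 * l) :
    symmetrize F d = F (2 * k + 1) (2 * l) := by
  have hp : coordP d = 2 * k + 1 := by rw [coordP]; omega
  have hq : coordQ d = 2 * l := by rw [coordQ]; omega
  rw [symmetrize, hp, hq, if_pos ⟨⟨k, rfl⟩, even_two_mul l⟩]

theorem symmetrize_of_even_odd (F : ℤ → ℤ → ℝ) {d : ℤ × ℤ} {k l : ℤ}
    (h1 : d.1 = 2 * k - (2 * l + 1)) (h2 : d.2 = 2 * k + (2 * l + 1)) :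
    symmetrize F d = F (2 * l + 1) (2 * k) := by
  have hp : coordP d = 2 * k := by rw [coordP]; omega
  have hq : coordQ d = 2 * l + 1 := by rw [coordQ]; omega
  rw [symmetrize, hp, hq, if_neg, if_pos ⟨even_two_mul k, ⟨l, rfl⟩⟩]
  rintro ⟨h, -⟩
  exact (Int.not_odd_iff_even.2 (even_two_mul k)) h

theorem zetaSign_eq {x y : ℤ × ℤ} {j : ℤ} (h : (y.2 - x.1 - 2 * j) % 4 = 0) :
    zetaSign x y = (-1) ^ j := by
  obtain ⟨i, hi⟩ : ∃ i, (y.2 - x.1) / 2 = j + 2 * i := ⟨(y.2 - x.1 - 2 * j) / 4, by omega⟩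
  rw [zetaSign, hi, zpow_add₀ (by norm_num), zpow_mul]
  norm_num

theorem two_mul_abs_le {k b : ℤ} (h1 : 2 * k ≤ b) (h2 : -(2 * k) ≤ b) : 2 * |k| ≤ b := by
  rcases abs_choice k with h | h <;> omega

/-- In lattice coordinates, `𝕂⁻¹(x, y)` is a combination of two neighbouring Green functions. -/
theorem exists_planeInverse_eq {x y : ℤ × ℤ} (hx : IsWhite x) (hy : IsBlack y) :
    ∃ k l p : ℤ, p.natAbs = (2 * k + 1).natAbs ∧ ‖1 / sigmaPhase x y‖ = 1 ∧
      zetaSign x y = (-1) ^ (k + l) ∧ (∀ F, symmetrize F (y - x) = F p (2 * l)) ∧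
      2 * |k| ≤ |y.1 - x.1| + |y.2 - x.2| + 2 ∧ 2 * |l| ≤ |y.1 - x.1| + |y.2 - x.2| ∧
      ∀ a : ℝ, 0 < a → a < 1 → planeInverse a 0 0 x y = 1 / sigmaPhase x y *
        (1 / (4 * (Real.pi : ℂ) ^ 2) * (a * latticeGreen a k l + latticeGreen a (k + 1) l)) := by
  obtain ⟨⟨hx1, hx2⟩, hy1, hy2⟩ := hx, hy
  rw [Int.odd_iff] at hx1 hy2
  rw [Int.even_iff] at hx2 hy1
  have n1 := le_abs_self (y.1 - x.1)
  have n2 := neg_abs_le (y.1 - x.1)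
  have n3 := le_abs_self (y.2 - x.2)
  have n4 := neg_abs_le (y.2 - x.2)
  have tx : vertexType x = 0 ∧ (x.1 + x.2) % 4 = 1 ∨ vertexType x = 1 ∧ (x.1 + x.2) % 4 = 3 := by
    unfold vertexType
    split_ifs with h
    · exact Or.inl ⟨rfl, h⟩
    · exact Or.inr ⟨rfl, by omega⟩
  have ty : vertexType y = 0 ∧ (y.1 + y.2) % 4 = 1 ∨ vertexType y = 1 ∧ (y.1 + y.2) % 4 = 3 := by
    unfold vertexType
    split_ifs with h
    · exact Or.inl ⟨rfl, h⟩
    · exact Or.inr ⟨rfl, by omega⟩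
  rcases tx with ⟨tx, sx⟩ | ⟨tx, sx⟩ <;> rcases ty with ⟨ty, sy⟩ | ⟨ty, sy⟩
  · obtain ⟨u, hu⟩ : ∃ u, u = (y.1 - x.1 + (y.2 - x.2)) / 4 := ⟨_, rfl⟩
    obtain ⟨v, hv⟩ : ∃ v, v = (y.2 - x.2 - 1 - (y.1 - x.1 + 1)) / 4 := ⟨_, rfl⟩
    have h1 : y.1 - x.1 = 2 * u - (2 * v + 1) := by omega
    have h2 : y.2 - x.2 = 2 * u + (2 * v + 1) := by omega
    have hS := sigmaPhase_eq_I h1 h2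
    -- Here `q` is odd, so the coordinates are exchanged: `k` comes from `v` and `l` from `u`.
    refine ⟨v, u, 2 * v + 1, rfl, by simp [hS], zetaSign_eq (by omega),
      fun F => symmetrize_of_even_odd F h1 h2, two_mul_abs_le (by omega) (by omega),
      two_mul_abs_le (by omega) (by omega), fun a ha ha' => ?_⟩
    rw [planeInverse, tx, ty, hS, latticeGreen_swap ha ha' v, latticeGreen_swap ha ha' (v + 1),
      ← mul_assoc, ← torusIntegral_zero_zero ha ha']
    congr 1 <;> simp [domainOffset, e2] <;> omega
  · obtain ⟨u, hu⟩ : ∃ u, u = (y.1 - x.1 - 1 + (y.2 - x.2 - 1)) / 4 := ⟨_, rfl⟩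
    obtain ⟨v, hv⟩ : ∃ v, v = (y.2 - x.2 - (y.1 - x.1)) / 4 := ⟨_, rfl⟩
    have h1 : y.1 - x.1 = 2 * u + 1 - 2 * v := by omega
    have h2 : y.2 - x.2 = 2 * u + 1 + 2 * v := by omega
    have hS := sigmaPhase_eq_one h1 h2
    refine ⟨u, v, 2 * u + 1, rfl, by simp [hS], zetaSign_eq (by omega),
      fun F => symmetrize_of_odd_even F h1 h2, two_mul_abs_le (by omega) (by omega),
      two_mul_abs_le (by omega) (by omega), fun a ha ha' => ?_⟩
    rw [planeInverse, tx, ty, hS, div_one, ← mul_assoc, ← torusIntegral_zero_one ha ha']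
    congr 1 <;> simp [domainOffset, e1] <;> omega
  · obtain ⟨u, hu⟩ : ∃ u, u = (y.1 - x.1 + 1 + (y.2 - x.2 + 1)) / 4 := ⟨_, rfl⟩
    obtain ⟨v, hv⟩ : ∃ v, v = (y.2 - x.2 - (y.1 - x.1)) / 4 := ⟨_, rfl⟩
    have h1 : y.1 - x.1 = 2 * (u - 1) + 1 - 2 * v := by omega
    have h2 : y.2 - x.2 = 2 * (u - 1) + 1 + 2 * v := by omega
    have hS := sigmaPhase_eq_one h1 h2
    -- The entry involves `u` and `u - 1`; evenness turns them into `-u` and `-u + 1`. Thus `p = 2 u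
    -- - 1` is the negative of `2 k + 1`, which is why only absolute values are matched.
    refine ⟨-u, v, 2 * (u - 1) + 1, by omega, by simp [hS], zetaSign_eq (by omega),
      fun F => symmetrize_of_odd_even F h1 h2, two_mul_abs_le (by omega) (by omega),
      two_mul_abs_le (by omega) (by omega), fun a ha ha' => ?_⟩
    rw [planeInverse, tx, ty, hS, div_one, ← mul_assoc, latticeGreen_neg ha ha',
      show -u + 1 = -(u - 1) by ring, latticeGreen_neg ha ha', ← torusIntegral_one_zero ha ha']
    congr 1 <;> simp [domainOffset, e1] <;> omega
  · obtain ⟨u, hu⟩ : ∃ u, u = (y.1 - x.1 + (y.2 - x.2)) / 4 := ⟨_, rfl⟩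
    obtain ⟨v, hv⟩ : ∃ v, v = (y.2 - x.2 + 1 - (y.1 - x.1 - 1)) / 4 := ⟨_, rfl⟩
    have h1 : y.1 - x.1 = 2 * u - (2 * (v - 1) + 1) := by omega
    have h2 : y.2 - x.2 = 2 * u + (2 * (v - 1) + 1) := by omega
    have hS := sigmaPhase_eq_I h1 h2
    refine ⟨-v, u, 2 * (v - 1) + 1, by omega, by simp [hS], zetaSign_eq (by omega),
      fun F => symmetrize_of_even_odd F h1 h2, two_mul_abs_le (by omega) (by omega),
      two_mul_abs_le (by omega) (by omega), fun a ha ha' => ?_⟩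
    rw [planeInverse, tx, ty, hS, latticeGreen_neg ha ha', show -v + 1 = -(v - 1) by ring,
      latticeGreen_neg ha ha', latticeGreen_swap ha ha' v, latticeGreen_swap ha ha' (v - 1),
      ← mul_assoc, ← torusIntegral_one_one ha ha']
    congr 1 <;> simp [domainOffset, e2] <;> omega

/-- Displacements bounded by `R` allow only finitely many `(k, l)`, all with `|k|, |l| ≤ R + 1`, so
the sum of the nonnegative constants serves for all of them. -/
theorem exists_norm_planeInverse_sub_le (R : ℕ) : ∃ C : ℝ, 0 ≤ C ∧ ∀ h : ℝ, 0 < h → h ≤ 1 / 2 →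
    ∀ x y : ℤ × ℤ, IsWhite x → IsBlack y → |y.1 - x.1| ≤ (R : ℤ) → |y.2 - x.2| ≤ (R : ℤ) →
      ‖planeInverse (1 - h) 0 0 x y - 1 / sigmaPhase x y *
        (expansion h (c0 (y - x)) (zetaSign x y) (c2 (y - x)) : ℝ)‖ ≤
        C * (h ^ 2 * (1 + |Real.log h|)) := by
  choose C hC hmain using exists_norm_latticeGreen_combination_le
  set s : Finset ℤ := Finset.Icc (-(R + 1 : ℤ)) (R + 1)
  refine ⟨∑ k ∈ s, ∑ l ∈ s, C k l, Finset.sum_nonneg fun k _ => Finset.sum_nonneg fun l _ => hC k l,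
    fun h h0 h1 x y hx hy hR1 hR2 => ?_⟩
  obtain ⟨k, l, p, hp, hS, hζ, hF, hk, hl, hK⟩ := exists_planeInverse_eq hx hy
  have hks : k ∈ s := by rw [Finset.mem_Icc, ← abs_le]; omega
  have hls : l ∈ s := by rw [Finset.mem_Icc, ← abs_le]; omega
  have hsum : C k l ≤ ∑ k ∈ s, ∑ l ∈ s, C k l :=
    (Finset.single_le_sum (f := fun l => C k l) (fun l _ => hC k l) hls).trans
      (Finset.single_le_sum (f := fun k => ∑ l ∈ s, C k l)
        (fun k _ => Finset.sum_nonneg fun l _ => hC k l) hks)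
  have e := hmain k l h h0 h1 p hp
  rw [hK (1 - h) (by linarith) (by linarith), hζ, c0, c2, hF, hF, ← mul_sub, norm_mul, hS, one_mul]
  exact e.trans (mul_le_mul_of_nonneg_right hsum (by positivity))

/-! ### From `h` to `m` -/

theorem smallParam_sq_mul_le {B : ℝ} (hB : 0 < B) {m : ℕ} (hm : 1 ≤ Real.log m) :
    smallParam B m ^ 2 * (1 + |Real.log (smallParam B m)|) ≤
      B ^ 2 * (2 + |Real.log B|) * ((m : ℝ)⁻¹ * Real.log m) := by
  have hm0 : (0 : ℝ) < m := by
    rcases Nat.eq_zero_or_pos m with h | h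
    · simp [h] at hm
      linarith
    · exact_mod_cast h
  have h1 : smallParam B m ^ 2 = B ^ 2 * (m : ℝ)⁻¹ := by
    rw [smallParam, mul_pow, ← Real.rpow_natCast (_ ^ _), ← Real.rpow_mul hm0.le]
    norm_num [Real.rpow_neg_one]
  have h2 : Real.log (smallParam B m) = Real.log B + -(1 / 2) * Real.log m := by
    rw [smallParam, Real.log_mul hB.ne' (Real.rpow_pos_of_pos hm0 _).ne', Real.log_rpow hm0]
  have h3 : |Real.log (smallParam B m)| ≤ |Real.log B| + 1 / 2 * Real.log m := by
    rw [h2]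
    refine (abs_add_le _ _).trans ?_
    rw [abs_mul, abs_neg, abs_of_pos (by norm_num : (0 : ℝ) < 1 / 2),
      abs_of_nonneg (by linarith : 0 ≤ Real.log m)]
  have h4 : 1 + |Real.log (smallParam B m)| ≤ (2 + |Real.log B|) * Real.log m := by
    nlinarith [abs_nonneg (Real.log B)]
  rw [h1]
  calc _ ≤ B ^ 2 * (m : ℝ)⁻¹ * ((2 + |Real.log B|) * Real.log m) := by gcongr
    _ = _ := by ring

theorem tendsto_smallParam (B : ℝ) : Tendsto (smallParam B) atTop (nhds 0) := by
  have h := ((tendsto_rpow_neg_atTop (by norm_num : (0 : ℝ) < 1 / 2)).comp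
    tendsto_natCast_atTop_atTop).const_mul B
  rw [mul_zero] at h
  exact h

end TwoPeriodicAztec

theorem mainTheorem5 (B : ℝ) (hB : 0 < B) (R : ℕ) :
    ∃ C : ℝ, ∀ᶠ m : ℕ in atTop, ∀ x y : ℤ × ℤ, IsWhite x → IsBlack y →
      |y.1 - x.1| ≤ (R : ℤ) → |y.2 - x.2| ≤ (R : ℤ) →
      ‖planeInverse (1 - smallParam B m) 0 0 x y -
        1 / sigmaPhase x y *
          ((c0 (y - x) + c0 (y - x) * smallParam B m / 2 +
            zetaSign x y *
              (c1 (y - x) * smallParam B m * Real.log (smallParam B m) +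
                c2 (y - x) * smallParam B m) : ℝ) : ℂ)‖
        ≤ C * ((m : ℝ)⁻¹ * Real.log m) := by
  obtain ⟨C, hC, hmain⟩ := exists_norm_planeInverse_sub_le R
  refine ⟨C * (B ^ 2 * (2 + |Real.log B|)), ?_⟩
  have hlog := (Real.tendsto_log_atTop.comp tendsto_natCast_atTop_atTop).eventually_ge_atTop
    (f := Real.log ∘ ((↑) : ℕ → ℝ)) 1
  filter_upwards [(tendsto_smallParam B).eventually_le_const (by norm_num : (0 : ℝ) < 1 / 2),
    hlog, eventually_gt_atTop 0] with m h1 hm hm0 x y hx hy hR1 hR2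
  have h0 : 0 < smallParam B m := mul_pos hB (Real.rpow_pos_of_pos (by exact_mod_cast hm0) _)
  -- The default value `0` of `symmetrize` is never taken, by the parities of a white and a black
  -- vertex.
  have hc1 : c1 (y - x) = 1 / (2 * Real.pi) := by
    obtain ⟨k, l, p, -, -, -, hF, -⟩ := exists_planeInverse_eq hx hy
    rw [c1, hF]
  have e := hmain _ h0 h1 x y hx hy hR1 hR2
  rw [expansion] at e
  rw [hc1, mul_assoc C]
  exact e.trans (mul_le_mul_of_nonneg_left (smallParam_sq_mul_le hB hm) hC)
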